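/- **Setting.** Let $\mathcal X$ be a measurable space, $\mathcal Y=\{-1,+1\}$, $P$ a probability measure on $\mathcal X\times\mathcal Y$, $S_m=((x_1,y_1),\dots,(x_m,y_m))$ the first $m$ elements of an i.i.d. sequence with law $P$, and $\mathrm{er}(h)=P((x,y):h(x)\ne y)$. Let $\mathcal F$ be a set of measurable classifiers $h:\mathcal X\to\mathcal Y$ of finite VC dimension $d$, satisfying the usual type of measurability condition: for all $k$ and $p\in\mathcal Y^k$ the set $\{(x_1,\dots,x_k):\exists f\in\mathcal F\ \forall i\ f(x_i)=p_i\}$ is measurable up to a null set of the $k$-fold product of the marginal of $P$ on $\mathcal X$. Let $f^\star$ be an infimal hypothesis of $\mathcal F$: a measurable classifier with $\mathrm{er}(f^\star)=\inf_{h\in\mathcal F}\mathrm{er}(h)$ and $\inf_{h\in\mathcal F}P((x,y):h(x)\neq f^\star(x))=0$, and with $f^\star\in\mathcal F$ whenever the infimum of $\mathrm{er}$ over $\mathcal F$ is attained. (All that follows holds for every such choice of $f^\star$.) *Compression set size.* For a finite sequence $S$ of points of $\mathcal X\times\mathcal Y$ let $\mathrm{VS}_{\mathcal F,S,f^\star}=\{h\in\mathcal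 F: h(x)=f^\star(x)\ \forall (x,y)\in S\}$, and let $\hat n(\mathcal F,S,f^\star)$ be the size of a smallest subsample $C$ of $S$ with $\mathrm{VS}_{\mathcal F,C,f^\star}=\mathrm{VS}_{\mathcal F,S,f^\star}$. Put $\mathcal B_{\hat n}(m,\eta)=\min\{b\in\{0,1,2,\dots\}:\mathbb P(\hat n(\mathcal F,S_m,f^\star)\le b)\ge 1-\eta\}$. *Algorithm.* For a finite list $Q$ of labeled points let $|Q|\,\mathrm{er}_Q(h)$ be the number of $(x,y)\in Q$ with $h(x)\ne y$; for $V\subseteq\mathcal F$ let $\mathrm{DIS}(V)=\{x:\exists h,g\in V,\ h(x)\ne g(x)\}$ and $\hat D_Q(V)=\max_{h,g\in V}|\{(x,y)\in Q:h(x)\neq g(x)\}|$. With $\delta_m=\delta/(\log_2(2m))^2$ put $$\mathcal E_m=\frac{1024}{m}\Bigl(d\ln\frac{e\max(m,d)}{d}+\ln\frac1{\delta_m}\Bigr),\qquad U_m(Q,V)=\sqrt{\frac{\hat D_Q(V)}{m}\,\mathcal E_m}+\mathcal E_m$$ (the term $d\ln(\cdot)$ is $0$ if $d=0$). RobustCAL$_\delta$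 with arguments $n$ (label budget) and $u$ (unlabeled budget) is the following algorithm. 0. $m\gets0$, $Q\gets\emptyset$, $V\gets\mathcal F$. 1. While $|Q|<n$ and $m<u$: 2. $\quad m\gets m+1$; if $x_m\in\mathrm{DIS}(V)$, request the label $y_m$ and append $(x_m,y_m)$ to the list $Q$; 3. $\quad$ if $m$ is a power of $2$, $V\gets\{h\in V:(\mathrm{er}_Q(h)-\min_{g\in V}\mathrm{er}_Q(g))\,|Q|\le m\,U_m(Q,V)\}$. 4. Return any $\hat f\in V$. **Theorem.** There is a finite universal constant $c>0$ such that the following holds for all $\mathcal X,P,\mathcal F,d,f^\star$ as above. Let $a\in[1,\infty)$ and $\alpha\in[0,1]$ be such that $$P((x,y):f(x)\neq f^\star(x))\le a\,(\mathrm{er}(f)-\mathrm{er}(f^\star))^\alpha\quad\text{for every } f\in\mathcal F$$ (with $0^0=1$), and let $\epsilon,\delta\in(0,1/2)$. For all $n,u$ and all data sequences, RobustCAL$_\delta$ with arguments $n$ and $u$ requests at most $n$ labels, and its final set $V$ is a nonempty subset of $\mathcal F$. Moreover there is $u_0$ such that for all $u\ge u_0$ and all $$n\ge c\,a^2\Bigl(\max_{r>a\epsilon^\alpha}\mathcal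 B_{\hat n}\bigl(\lceil 1/r\rceil,\tfrac1{20}\bigr)+1\Bigr)\Bigl(\frac1\epsilon\Bigr)^{2-2\alpha}\Bigl(d\log\frac1\epsilon+\log\frac1\delta\Bigr)\log\frac1\epsilon,$$ however the returned $\hat f\in V$ is chosen, with probability at least $1-\delta$ it satisfies $\mathrm{er}(\hat f)\le\mathrm{er}(f^\star)+\epsilon$. -/

import Mathlib

open MeasureTheory

/-! Instances are points of a measurable space `X`; labels `-1, +1` are the Booleans `false, true`;
`P` is the data distribution, a probability measure on `X × Bool`. -/

namespace ActiveLearning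

variable {X : Type*}

/-- The error rate `er(h) = P((x, y) : h(x) ≠ y)`. -/
noncomputable def errorRate [MeasurableSpace X] (P : Measure (X × Bool)) (h : X → Bool) : ℝ :=
  P.real {z | h z.1 ≠ z.2}

/-- The probability `P((x, y) : h(x) ≠ g(x))` that two classifiers disagree. -/
noncomputable def disagreeProb [MeasurableSpace X] (P : Measure (X × Bool)) (h g : X → Bool) : ℝ :=
  P.real {z | h z.1 ≠ g z.1}

/-- `F` realizes all `2 ^ |s|` classifications of the points of `s`. -/
def Shatters (F : Set (X → Bool)) (s : Finset X) : Prop :=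
  ∀ p : X → Bool, ∃ f ∈ F, ∀ x ∈ s, f x = p x

/-- The VC dimension of `F` is finite and equal to `d` (in particular `F` is nonempty). -/
def HasVCDim (F : Set (X → Bool)) (d : ℕ) : Prop :=
  IsGreatest {k | ∃ s : Finset X, s.card = k ∧ Shatters F s} d

/-- The measurability condition on the class: its members are measurable and, for every finite
pattern of labels, the set of tuples of points on which some member of `F` produces this pattern is
measurable up to a null set. -/
structure MeasurableClass [MeasurableSpace X] (P : Measure (X × Bool)) (F : Set (X → Bool)) :
    Prop where
  measurable : ∀ f ∈ F, Measurable f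
  nullMeasurable_trace : ∀ (k : ℕ) (p : Fin k → Bool),
    NullMeasurableSet {x : Fin k → X | ∃ f ∈ F, ∀ i, f (x i) = p i}
      (Measure.pi fun _ : Fin k => P.fst)

/-- `fstar` is an infimal hypothesis of `F` with respect to `P`. -/
structure IsInfimal [MeasurableSpace X] (P : Measure (X × Bool)) (F : Set (X → Bool))
    (fstar : X → Bool) : Prop where
  measurable : Measurable fstar
  isGLB_errorRate : IsGLB (errorRate P '' F) (errorRate P fstar)
  isGLB_disagreeProb : IsGLB ((fun h => disagreeProb P h fstar) '' F) 0
  mem_of_attained : (∃ f ∈ F, IsLeast (errorRate P '' F) (errorRate P f)) → fstar ∈ F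

/-- The Mammen-Tsybakov noise condition with parameters `a` and `α`. (Here `0 ^ 0 = 1`, so that the
condition is void for `α = 0`.) -/
def MammenTsybakov [MeasurableSpace X] (P : Measure (X × Bool)) (F : Set (X → Bool))
    (fstar : X → Bool) (a α : ℝ) : Prop :=
  ∀ f ∈ F, disagreeProb P f fstar ≤ a * (errorRate P f - errorRate P fstar) ^ α

/-- The agnostic version space of the part of the sample `S` with indices in `C`: the members of
`F` that agree with `fstar` on it. -/
def agnosticVersionSpace {m : ℕ} (F : Set (X → Bool)) (S : Fin m → X × Bool) (fstar : X → Bool)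
    (C : Finset (Fin m)) : Set (X → Bool) :=
  {h ∈ F | ∀ i ∈ C, h (S i).1 = fstar (S i).1}

/-- The agnostic version space compression set size: the size of a smallest subsample that induces
the same agnostic version space as the whole sample. -/
noncomputable def compressionSize {m : ℕ} (F : Set (X → Bool)) (S : Fin m → X × Bool)
    (fstar : X → Bool) : ℕ :=
  sInf {k | ∃ C : Finset (Fin m), C.card = k ∧
    agnosticVersionSpace F S fstar C = agnosticVersionSpace F S fstar Finset.univ}

/-- The minimal bound `min {b : ℙ(n̂(F, S_m, fstar) ≤ b) ≥ 1 - δ}` on the agnostic version space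
compression set size of an i.i.d. sample of size `m`. (The minimum exists, since `b = m` is
admissible.) -/
noncomputable def compressionBound [MeasurableSpace X] (P : Measure (X × Bool))
    (F : Set (X → Bool)) (fstar : X → Bool) (m : ℕ) (δ : ℝ) : ℕ :=
  sInf {b | 1 - δ ≤
    (Measure.pi fun _ : Fin m => P).real {S | compressionSize F S fstar ≤ b}}

/-- `max_{r > r₀}` of the minimal bound for sample size `⌈1/r⌉` at confidence level `1/20`. (For
`r₀ > 0` this is the maximum of finitely many natural numbers.) -/
noncomputable def maxCompressionBound [MeasurableSpace X] (P : Measure (X × Bool))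
    (F : Set (X → Bool)) (fstar : X → Bool) (r₀ : ℝ) : ℕ :=
  sSup {b | ∃ r : ℝ, r₀ < r ∧ b = compressionBound P F fstar ⌈1 / r⌉₊ (1 / 20)}

/-- The region of disagreement of a set of classifiers. -/
def disagreementRegion (V : Set (X → Bool)) : Set X :=
  {x | ∃ h ∈ V, ∃ g ∈ V, h x ≠ g x}

/-- The number of mistakes of `h` on the list `Q` of labeled points, `|Q| er_Q(h)`. -/
def mistakes (Q : List (X × Bool)) (h : X → Bool) : ℕ :=
  Q.countP fun z => h z.1 != z.2

/-- The largest number of points of `Q` on which two members of `V` disagree. -/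
noncomputable def empiricalDiameter (Q : List (X × Bool)) (V : Set (X → Bool)) : ℕ :=
  sSup {k | ∃ h ∈ V, ∃ g ∈ V, k = Q.countP fun z => h z.1 != g z.1}

/-- The confidence level `δ_m = δ / (log₂ (2m))²` used after `m` unlabeled points. -/
noncomputable def confidence (δ : ℝ) (m : ℕ) : ℝ :=
  δ / Real.logb 2 (2 * m) ^ 2

/-- The squared uniform-convergence scale for VC dimension `d` and sample size `m`,
`(1024 / m) (d ln (e max(m, d) / d) + ln (1 / δ_m))`. (For `d = 0` the first summand is `0`.) -/
noncomputable def deviationScale (d : ℕ) (δ : ℝ) (m : ℕ) : ℝ :=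
  1024 / m * (d * Real.log (Real.exp 1 * max (m : ℝ) d / d) + Real.log (1 / confidence δ m))

/-- The data-dependent bound on the deviations of empirical from true excess errors between members
of `V` after `m` unlabeled points. Since all members of `V` agree on those of the `m` points whose
label was not requested, `empiricalDiameter Q V / m` is the empirical diameter of `V` on all of
the first `m` points. -/
noncomputable def deviationBound (d : ℕ) (δ : ℝ) (m : ℕ) (Q : List (X × Bool))
    (V : Set (X → Bool)) : ℝ :=
  √(empiricalDiameter Q V / m * deviationScale d δ m) + deviationScale d δ m

/-- The state of RobustCAL: the number of unlabeled points seen so far, the list of the labeled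
points whose labels were requested (the latest first), and the current set of classifiers. -/
structure RobustCALState (X : Type*) where
  seen : ℕ
  requested : List (X × Bool)
  candidates : Set (X → Bool)

open Classical in
/-- One round of RobustCAL: take the next unlabeled point; request its label if and only if two
candidates disagree on it; whenever the number `m` of points seen is a power of two, keep only
the candidates `h` with `|Q| (er_Q(h) - min_{g ∈ V} er_Q(g)) ≤ m U(m, δ_m)`.
The oracle `label` is consulted only for requested points. -/
noncomputable def robustCALStep (d : ℕ) (δ : ℝ) (point : ℕ → X) (label : ℕ → Bool)
    (s : RobustCALState X) : RobustCALState X :=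
  let m := s.seen + 1
  let Q := if point s.seen ∈ disagreementRegion s.candidates then
      (point s.seen, label s.seen) :: s.requested else s.requested
  let V := if ∃ i : ℕ, m = 2 ^ i then
      {h ∈ s.candidates | ∀ g ∈ s.candidates,
        (mistakes Q h : ℝ) - mistakes Q g ≤ m * deviationBound d δ m Q s.candidates}
    else s.candidates
  ⟨m, Q, V⟩

/-- RobustCAL with confidence parameter `δ` for the class `F` of VC dimension `d`, given the
arguments `n` (label budget) and `u` (unlabeled budget): starting from no points and `V = F`,
perform rounds while fewer than `n` labels were requested and fewer than `u` points were seen.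
(Each round increases the number of points seen, so `u` guarded rounds exhaust the loop.)
The algorithm returns any element of the final set `candidates`. -/
noncomputable def robustCAL (F : Set (X → Bool)) (d : ℕ) (δ : ℝ) (n u : ℕ) (point : ℕ → X)
    (label : ℕ → Bool) : RobustCALState X :=
  (fun s => if s.requested.length < n ∧ s.seen < u then robustCALStep d δ point label s else s)^[u]
    ⟨0, [], F⟩

end ActiveLearning

/-! The run splits into stages, stage `i` ending after `2 ^ i` unlabeled points. All candidates
agree at a point whose label is not requested, so differences of mistake counts and empirical
diameters computed from `Q` are those of the whole sample (`mistakes_sub_mistakes_eq`,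
`countP_bne_eq`). Uniform convergence for i.i.d. samples therefore applies although the queries are
adaptive.

Error. A Vapnik-Chervonenkis relative deviation bound for the sets `errorDiff f g`, obtained by
symmetrization (`measure_exists_deviation_le`), holds at all sizes `2 ^ i`, `i ≤ I`, outside an
event of measure at most `δ / 4`. Then a near-optimal `g ∈ F` is never discarded. If the candidates
have excess error at most `ρ`, the noise condition bounds their distance to `fstar` by `a * ρ ^ α`,
so the next threshold is of order `√(a ρ^α e) + e` with `e = deviationScale`. The recursion closes
for `ρ i ^ (2 - α) = 100 a Λ / 2 ^ i`, where `Λ` is of order `d log (1/ε) + log (1/δ)`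
(`excess_le_of_concentrated`).

Labels. `exists_disagreement_cover` bounds the region where classifiers near `fstar` can differ from
it, by a leave-one-out argument: a sample point in that region is, with probability at least `3/4`,
not determined by the other points, and such a point belongs to every compression set. Hence the
region has probability at most of order `(B + 1) r`. A point between `2 ^ i` and `2 ^ (i + 1)` is
thus requested only inside a fixed set of probability of order `(B + 1) a (ρ i)^α`, which costs
about `a² (B + 1) ε^(2α - 2) Λ` labels per stage. Only the last `O(log (1/ε))` stages need this
bound; the earlier ones contain `O(Λ)` points altogether. Chernoff's bound for the fixed covering
sets controls the number of requests outside another event of measure at most `δ / 4`. -/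

namespace ActiveLearning

/-! ### Sauer-Shelah bounds and Hoeffding's inequality for random signs -/

section Combinatorics

/-- Sauer-Shelah for the traces of a class of finite VC dimension. -/
theorem ncard_trace_le {X : Type*} {F : Set (X → Bool)} {d : ℕ} (hF : HasVCDim F d)
    {ι : Type*} [Fintype ι] (x : ι → X) :
    {p : ι → Bool | ∃ f ∈ F, ∀ i, f (x i) = p i}.ncard ≤
      ∑ k ∈ Finset.Iic d, (Fintype.card ι).choose k := by
  classical
  let φ : (ι → Bool) → Finset ι := fun p => Finset.univ.filter fun i => p i = true
  have hφ : Function.Injective φ := by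
    intro p q h
    funext i
    have := congrArg (fun s => i ∈ s) h
    simp only [φ, Finset.mem_filter, Finset.mem_univ, true_and, eq_iff_iff] at this
    exact Bool.eq_iff_iff.2 this
  let T : Finset (ι → Bool) := {p : ι → Bool | ∃ f ∈ F, ∀ i, f (x i) = p i}.toFinset
  let 𝒜 : Finset (Finset ι) := T.image φ
  have h1 : {p : ι → Bool | ∃ f ∈ F, ∀ i, f (x i) = p i}.ncard = 𝒜.card := by
    rw [Set.ncard_eq_toFinset_card', Finset.card_image_of_injective _ hφ]
  rw [h1]
  refine (Finset.card_le_card_shatterer 𝒜).trans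
    (Finset.card_shatterer_le_sum_vcDim.trans ?_)
  refine Finset.sum_le_sum_of_subset (Finset.Iic_subset_Iic.2 ?_)
  refine Finset.sup_le fun s hs => ?_
  rw [Finset.mem_shatterer] at hs
  have key : ∀ t ⊆ s, ∃ f ∈ F, ∀ i ∈ s, (f (x i) = true ↔ i ∈ t) := by
    intro t ht
    obtain ⟨u, hu, hut⟩ := hs ht
    simp only [𝒜, T, Finset.mem_image, Set.mem_toFinset, Set.mem_ofPred_eq] at hu
    obtain ⟨p, ⟨f, hf, hfp⟩, rfl⟩ := hu
    refine ⟨f, hf, fun i hi => ?_⟩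
    rw [← hut]
    simp [φ, hi, hfp]
  -- A repeated instance gets equal labels from every classifier, so a shattered set of indices has
  -- distinct instances, and its image is a shattered set of the same size.
  have hinj : Set.InjOn x s := by
    intro i hi j hj hij
    obtain ⟨f, -, hf⟩ := key {i} (by simpa using hi)
    have h1 := (hf i hi).2 (by simp)
    rw [hij] at h1
    have := (hf j hj).1 h1
    exact (Finset.mem_singleton.1 this).symm
  refine hF.2 ⟨s.image x, Finset.card_image_of_injOn hinj, fun p => ?_⟩
  obtain ⟨f, hf, hfs⟩ := key (s.filter fun i => p (x i) = true) (Finset.filter_subset _ _)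
  refine ⟨f, hf, fun y hy => ?_⟩
  obtain ⟨i, hi, rfl⟩ := Finset.mem_image.1 hy
  rw [Bool.eq_iff_iff, hfs i hi]
  simp [hi]

/-- Multiplying by `(d / n) ^ d ≤ (d / n) ^ k` for `k ≤ d` turns the sum into part of the binomial
expansion of `(1 + d / n) ^ n ≤ exp d`. -/
theorem sum_choose_le_exp_mul {d n : ℕ} (hd : 1 ≤ d) (hn : d ≤ n) :
    ((∑ k ∈ Finset.Iic d, n.choose k : ℕ) : ℝ) ≤ (Real.exp 1 * n / d) ^ d := by
  have hd' : (0 : ℝ) < d := by exact_mod_cast hd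
  have hn' : (0 : ℝ) < n := by exact_mod_cast hd.trans hn
  have hle : (d : ℝ) / n ≤ 1 := (div_le_one hn').2 (by exact_mod_cast hn)
  have h1 : ((∑ k ∈ Finset.Iic d, n.choose k : ℕ) : ℝ) * ((d : ℝ) / n) ^ d ≤ Real.exp d := by
    calc ((∑ k ∈ Finset.Iic d, n.choose k : ℕ) : ℝ) * ((d : ℝ) / n) ^ d
        = ∑ k ∈ Finset.Iic d, (n.choose k : ℝ) * ((d : ℝ) / n) ^ d := by
          push_cast; rw [Finset.sum_mul]
      _ ≤ ∑ k ∈ Finset.Iic d, (n.choose k : ℝ) * ((d : ℝ) / n) ^ k := by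
          refine Finset.sum_le_sum fun k hk => ?_
          exact mul_le_mul_of_nonneg_left
            (pow_le_pow_of_le_one (by positivity) hle (Finset.mem_Iic.1 hk)) (by positivity)
      _ ≤ ∑ k ∈ Finset.range (n + 1), (n.choose k : ℝ) * ((d : ℝ) / n) ^ k := by
          refine Finset.sum_le_sum_of_subset_of_nonneg (fun k hk => ?_) fun _ _ _ => by positivity
          have := Finset.mem_Iic.1 hk
          exact Finset.mem_range.2 (by omega)
      _ = ((d : ℝ) / n + 1) ^ n := by
          rw [add_pow]
          exact Finset.sum_congr rfl fun k _ => by ring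
      _ ≤ (Real.exp ((d : ℝ) / n)) ^ n :=
          pow_le_pow_left₀ (by positivity) (Real.add_one_le_exp _) _
      _ = Real.exp d := by
          rw [← Real.exp_nat_mul]; congr 1; field_simp
  have h2 : (Real.exp 1 * n / d) ^ d = Real.exp d / ((d : ℝ) / n) ^ d := by
    rw [← Real.exp_one_pow d, ← div_pow]
    congr 1
    field_simp
  rw [h2, le_div_iff₀ (by positivity)]
  exact h1

/-- The sum over signs factorizes into hyperbolic cosines, and `cosh x ≤ exp (x ^ 2 / 2)`. -/
theorem sum_signs_exp_le {m : ℕ} (a : Fin m → ℝ) (t : ℝ) :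
    ∑ σ : Fin m → Bool, Real.exp (t * ∑ i, (if σ i then -a i else a i)) ≤
      2 ^ m * Real.exp (t ^ 2 * (∑ i, a i ^ 2) / 2) := by
  have h1 : ∀ σ : Fin m → Bool, Real.exp (t * ∑ i, (if σ i then -a i else a i)) =
      ∏ i, Real.exp (t * (if σ i then -a i else a i)) := fun σ => by
    rw [Finset.mul_sum, Real.exp_sum]
  simp_rw [h1]
  have h2 := (Fintype.prod_sum (fun (i : Fin m) (b : Bool) =>
    Real.exp (t * (if b then -a i else a i)))).symm
  rw [h2]
  calc ∏ i, ∑ b : Bool, Real.exp (t * (if b then -a i else a i))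
      ≤ ∏ i : Fin m, (2 * Real.exp ((t * a i) ^ 2 / 2)) := by
        refine Finset.prod_le_prod (fun i _ => by positivity) fun i _ => ?_
        have := Real.cosh_le_exp_half_sq (t * a i)
        rw [Real.cosh_eq] at this
        simp only [Fintype.sum_bool, if_true, mul_neg]
        simp
        linarith
    _ = _ := by
        rw [Finset.prod_mul_distrib, ← Real.exp_sum]
        simp only [Finset.prod_const, Finset.card_univ, Fintype.card_fin]
        congr 2
        rw [Finset.mul_sum, Finset.sum_div]
        exact Finset.sum_congr rfl fun i _ => by ring

theorem card_signs_lt_le {m : ℕ} (a : Fin m → ℝ) {C Λ : ℝ} (hC : ∑ i, a i ^ 2 ≤ C)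
    (hC0 : 0 < C) (hΛ : 0 ≤ Λ) :
    ((Finset.univ.filter fun σ : Fin m → Bool =>
      √(2 * Λ * C) < ∑ i, (if σ i then -a i else a i)).card : ℝ) ≤ 2 ^ m * Real.exp (-Λ) := by
  set s := √(2 * Λ * C)
  have hs : s ^ 2 = 2 * Λ * C := Real.sq_sqrt (by positivity)
  have hs0 : 0 ≤ s := Real.sqrt_nonneg _
  -- The exponent `s / C` is the optimal one: counted signs contribute at least `exp (2 Λ)` each,
  -- and the total is at most `2 ^ m * exp Λ`.
  have h := sum_signs_exp_le a (s / C)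
  have h2 : (s / C) ^ 2 * (∑ i, a i ^ 2) / 2 ≤ Λ := by
    have : (s / C) ^ 2 * (∑ i, a i ^ 2) ≤ (s / C) ^ 2 * C :=
      mul_le_mul_of_nonneg_left hC (by positivity)
    have e : (s / C) ^ 2 * C = 2 * Λ := by rw [div_pow, hs]; field_simp
    linarith
  have h3 : ((Finset.univ.filter fun σ : Fin m → Bool =>
      s < ∑ i, (if σ i then -a i else a i)).card : ℝ) * Real.exp (2 * Λ) ≤
      ∑ σ : Fin m → Bool, Real.exp (s / C * ∑ i, (if σ i then -a i else a i)) := by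
    rw [← nsmul_eq_mul]
    refine (Finset.card_nsmul_le_sum _ _ _ fun σ hσ => ?_).trans
      (Finset.sum_le_sum_of_subset_of_nonneg (Finset.filter_subset _ _)
        fun _ _ _ => (Real.exp_pos _).le)
    refine Real.exp_le_exp.2 ?_
    have hlt := (Finset.mem_filter.1 hσ).2
    have e : s / C * s = 2 * Λ := by
      rw [div_mul_eq_mul_div, ← sq, hs]; field_simp
    rw [← e]
    exact mul_le_mul_of_nonneg_left hlt.le (by positivity)
  have h4 : ((Finset.univ.filter fun σ : Fin m → Bool =>
      s < ∑ i, (if σ i then -a i else a i)).card : ℝ) * Real.exp (2 * Λ) ≤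
      2 ^ m * Real.exp Λ :=
    h3.trans (h.trans (mul_le_mul_of_nonneg_left (Real.exp_le_exp.2 h2) (by positivity)))
  have h5 : (2 : ℝ) ^ m * Real.exp Λ = 2 ^ m * Real.exp (-Λ) * Real.exp (2 * Λ) := by
    rw [mul_assoc, ← Real.exp_add]; ring_nf
  rw [h5] at h4
  exact le_of_mul_le_mul_right h4 (Real.exp_pos _)

/-- Hoeffding's inequality for random signs, as a counting statement. -/
theorem card_signs_sq_lt_le {m : ℕ} (a : Fin m → ℝ) {C Λ : ℝ} (hC : ∑ i, a i ^ 2 ≤ C)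
    (hΛ : 0 ≤ Λ) :
    ((Finset.univ.filter fun σ : Fin m → Bool =>
      2 * Λ * C < (∑ i, (if σ i then -a i else a i)) ^ 2).card : ℝ) ≤
      2 ^ m * (2 * Real.exp (-Λ)) := by
  have ha0 : 0 ≤ ∑ i, a i ^ 2 := Finset.sum_nonneg fun i _ => sq_nonneg _
  rcases (ha0.trans hC).eq_or_lt with h0 | h0
  · have hz : ∀ i, a i = 0 := by
      have : ∑ i, a i ^ 2 = 0 := le_antisymm (hC.trans h0.symm.le) ha0
      intro i
      have := (Finset.sum_eq_zero_iff_of_nonneg fun i _ => sq_nonneg _).1 this i (Finset.mem_univ i)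
      exact pow_eq_zero_iff two_ne_zero |>.1 this
    have : (Finset.univ.filter fun σ : Fin m → Bool =>
      2 * Λ * C < (∑ i, (if σ i then -a i else a i)) ^ 2) = ∅ := by
      refine Finset.filter_eq_empty_iff.2 fun σ _ => ?_
      simp [hz, ← h0]
    rw [this]
    simp only [Finset.card_empty, Nat.cast_zero]
    positivity
  · have hsub : (Finset.univ.filter fun σ : Fin m → Bool =>
        2 * Λ * C < (∑ i, (if σ i then -a i else a i)) ^ 2) ⊆
        (Finset.univ.filter fun σ : Fin m → Bool =>
          √(2 * Λ * C) < ∑ i, (if σ i then -a i else a i)) ∪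
        (Finset.univ.filter fun σ : Fin m → Bool =>
          √(2 * Λ * C) < ∑ i, (if σ i then -(-a i) else -a i)) := by
      intro σ hσ
      have h := (Finset.mem_filter.1 hσ).2
      have h' := Real.sqrt_lt_sqrt (by positivity) h
      rw [Real.sqrt_sq_eq_abs] at h'
      rcases lt_abs.1 h' with h1 | h1
      · exact Finset.mem_union_left _ (by simpa using h1)
      · refine Finset.mem_union_right _ (Finset.mem_filter.2 ⟨Finset.mem_univ _, ?_⟩)
        rw [← Finset.sum_neg_distrib] at h1
        refine h1.trans_le (Finset.sum_le_sum fun i _ => ?_)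
        split_ifs <;> simp
    have h1 := card_signs_lt_le a hC h0 hΛ
    have h2 := card_signs_lt_le (fun i => -a i) (by simpa using hC) h0 hΛ
    have h3 := (Finset.card_le_card hsub).trans (Finset.card_union_le _ _)
    have h3' := (Nat.cast_le (α := ℝ)).2 h3
    rw [Nat.cast_add] at h3'
    linarith

end Combinatorics

/-! ### Uniform relative deviations by symmetrization with a ghost sample -/

section Symmetrization

variable {Z : Type*}

/-- The number of sample points in the set `A`. -/
noncomputable def count {m : ℕ} (S : Fin m → Z) (A : Set Z) : ℝ :=
  ∑ i, A.indicator (fun _ => (1 : ℝ)) (S i)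

open Classical in
/-- The membership pattern of a double sample in a set. -/
noncomputable def pairPattern {m : ℕ} (A : Set Z) (w : Fin m → Z × Z) : Fin m → Bool × Bool :=
  fun i => (decide ((w i).1 ∈ A), decide ((w i).2 ∈ A))

/-- Double samples on which some set of the class has very different frequencies in the halves. -/
def pairDeviation (𝒞 : Set (Set Z)) (m : ℕ) (Λ : ℝ) : Set (Fin m → Z × Z) :=
  {w | ∃ A ∈ 𝒞, 2 * Λ * (count (fun i => (w i).1) A + count (fun i => (w i).2) A) <
    (count (fun i => (w i).1) A - count (fun i => (w i).2) A) ^ 2}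

/-- The value `1` or `0` of a Boolean. -/
def boolVal (b : Bool) : ℝ := if b then 1 else 0

/-- Patterns with very different frequencies in the halves. -/
def PatternDeviation {m : ℕ} (Λ : ℝ) (p : Fin m → Bool × Bool) : Prop :=
  2 * Λ * ∑ i, (boolVal (p i).1 + boolVal (p i).2) <
    (∑ i, (boolVal (p i).1 - boolVal (p i).2)) ^ 2

theorem mem_pairDeviation {𝒞 : Set (Set Z)} {m : ℕ} {Λ : ℝ} {w : Fin m → Z × Z} :
    w ∈ pairDeviation 𝒞 m Λ ↔ ∃ A ∈ 𝒞, PatternDeviation Λ (pairPattern A w) := by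
  classical
  simp only [pairDeviation, PatternDeviation, Set.mem_ofPred_eq, Finset.sum_add_distrib,
    Finset.sum_sub_distrib, count, pairPattern, boolVal, Set.indicator_apply, decide_eq_true_eq]

/-- Exchange of the two points of those pairs that are marked by `σ`. -/
def swapPairs {m : ℕ} (σ : Fin m → Bool) (w : Fin m → Z × Z) : Fin m → Z × Z :=
  fun i => if σ i then (w i).swap else w i

/-- Swapping keeps the total count in the two halves and flips signs in their difference. For each
of the at most `N` patterns of `w`, Hoeffding applies with variance proxy equal to the total count,
because a difference of two bits has square at most their sum. -/
theorem card_swapPairs_mem_le {𝒞 : Set (Set Z)} {m N : ℕ} {Λ : ℝ} (hΛ : 0 ≤ Λ)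
    (w : Fin m → Z × Z) (hN : {p | ∃ A ∈ 𝒞, pairPattern A w = p}.ncard ≤ N)
    [DecidablePred fun σ : Fin m → Bool => swapPairs σ w ∈ pairDeviation 𝒞 m Λ] :
    ((Finset.univ.filter fun σ : Fin m → Bool =>
      swapPairs σ w ∈ pairDeviation 𝒞 m Λ).card : ℝ) ≤ N * (2 ^ m * (2 * Real.exp (-Λ))) := by
  classical
  let T : Finset (Fin m → Bool × Bool) := {p | ∃ A ∈ 𝒞, pairPattern A w = p}.toFinset
  have hT : T.card ≤ N := by rwa [Set.ncard_eq_toFinset_card'] at hN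
  let a : (Fin m → Bool × Bool) → Fin m → ℝ := fun p i => boolVal (p i).1 - boolVal (p i).2
  let C : (Fin m → Bool × Bool) → ℝ := fun p => ∑ i, (boolVal (p i).1 + boolVal (p i).2)
  have hsub : (Finset.univ.filter fun σ : Fin m → Bool =>
      swapPairs σ w ∈ pairDeviation 𝒞 m Λ) ⊆ T.biUnion fun p =>
        Finset.univ.filter fun σ : Fin m → Bool =>
          2 * Λ * C p < (∑ i, (if σ i then -a p i else a p i)) ^ 2 := by
    intro σ hσ
    obtain ⟨A, hA, h⟩ := mem_pairDeviation.1 (Finset.mem_filter.1 hσ).2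
    refine Finset.mem_biUnion.2 ⟨pairPattern A w, ?_, Finset.mem_filter.2 ⟨Finset.mem_univ _, ?_⟩⟩
    · simp only [T, Set.mem_toFinset, Set.mem_ofPred_eq]
      exact ⟨A, hA, rfl⟩
    · unfold PatternDeviation at h
      have e1 : ∀ i, boolVal (pairPattern A (swapPairs σ w) i).1 +
          boolVal (pairPattern A (swapPairs σ w) i).2 =
          boolVal (pairPattern A w i).1 + boolVal (pairPattern A w i).2 := by
        intro i
        cases hs : σ i <;> simp [pairPattern, swapPairs, hs, add_comm]
      have e2 : ∀ i, boolVal (pairPattern A (swapPairs σ w) i).1 -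
          boolVal (pairPattern A (swapPairs σ w) i).2 =
          if σ i then -a (pairPattern A w) i else a (pairPattern A w) i := by
        intro i
        cases hs : σ i <;> simp [pairPattern, swapPairs, hs, a]
      simp only [e1, e2] at h
      exact h
  have h1 := (Finset.card_le_card hsub).trans Finset.card_biUnion_le
  have h2 : ∀ p ∈ T, ((Finset.univ.filter fun σ : Fin m → Bool =>
      2 * Λ * C p < (∑ i, (if σ i then -a p i else a p i)) ^ 2).card : ℝ) ≤
      2 ^ m * (2 * Real.exp (-Λ)) := by
    intro p _
    refine card_signs_sq_lt_le (a p) (Finset.sum_le_sum fun i _ => ?_) hΛ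
    cases hx : (p i).1 <;> cases hy : (p i).2 <;> norm_num [boolVal, a, hx, hy]
  have h3 := (Nat.cast_le (α := ℝ)).2 h1
  rw [Nat.cast_sum] at h3
  refine h3.trans ((Finset.sum_le_sum h2).trans ?_)
  rw [Finset.sum_const, nsmul_eq_mul]
  exact mul_le_mul_of_nonneg_right (by exact_mod_cast hT) (by positivity)

variable [MeasurableSpace Z]

theorem measurable_count {m : ℕ} {A : Set Z} (hA : MeasurableSet A) :
    Measurable fun S : Fin m → Z => count S A := by
  unfold count
  exact Finset.measurable_sum _ fun i _ =>
    (measurable_const.indicator hA).comp (measurable_pi_apply i)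

variable (μ : Measure Z)

theorem nullMeasurableSet_pairDeviation {𝒞 : Set (Set Z)} {m : ℕ} {Λ : ℝ}
    (hnull : ∀ p : Fin m → Bool × Bool, NullMeasurableSet {w | ∃ A ∈ 𝒞, pairPattern A w = p}
      (Measure.pi fun _ : Fin m => μ.prod μ)) :
    NullMeasurableSet (pairDeviation 𝒞 m Λ) (Measure.pi fun _ : Fin m => μ.prod μ) := by
  have : pairDeviation 𝒞 m Λ = ⋃ p ∈ {p : Fin m → Bool × Bool | PatternDeviation Λ p},
      {w | ∃ A ∈ 𝒞, pairPattern A w = p} := by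
    ext w
    simp only [mem_pairDeviation, Set.mem_iUnion, Set.mem_ofPred_eq, exists_prop]
    constructor
    · rintro ⟨A, hA, h⟩
      exact ⟨_, h, A, hA, rfl⟩
    · rintro ⟨p, h, A, hA, rfl⟩
      exact ⟨A, hA, h⟩
  rw [this]
  exact NullMeasurableSet.biUnion (Set.to_countable _) fun p _ => hnull p

variable [IsProbabilityMeasure μ]

theorem measurePreserving_swapPairs {m : ℕ} (σ : Fin m → Bool) :
    MeasurePreserving (swapPairs (Z := Z) σ) (Measure.pi fun _ : Fin m => μ.prod μ)
      (Measure.pi fun _ : Fin m => μ.prod μ) := by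
  refine measurePreserving_pi _ _ (f := fun i (z : Z × Z) => if σ i then z.swap else z) fun i => ?_
  cases h : σ i
  · simp only [Bool.false_eq_true, if_false]
    exact MeasurePreserving.id _
  · simpa using Measure.measurePreserving_swap

/-- Each of the `2 ^ m` swaps preserves the measure, so the measure of the event is an average over
swaps, which is bounded pointwise in `w` by counting. -/
theorem measure_pairDeviation_le {𝒞 : Set (Set Z)} {m N : ℕ} {Λ : ℝ} (hΛ : 0 ≤ Λ)
    (hnull : ∀ p : Fin m → Bool × Bool, NullMeasurableSet {w | ∃ A ∈ 𝒞, pairPattern A w = p}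
      (Measure.pi fun _ : Fin m => μ.prod μ))
    (hN : ∀ w : Fin m → Z × Z, {p | ∃ A ∈ 𝒞, pairPattern A w = p}.ncard ≤ N) :
    (Measure.pi fun _ : Fin m => μ.prod μ) (pairDeviation 𝒞 m Λ) ≤
      ENNReal.ofReal (2 * N * Real.exp (-Λ)) := by
  classical
  set ν := Measure.pi fun _ : Fin m => μ.prod μ
  set E := pairDeviation 𝒞 m Λ
  have hE : NullMeasurableSet E ν := nullMeasurableSet_pairDeviation μ hnull
  have hσ : ∀ σ : Fin m → Bool, NullMeasurableSet (swapPairs σ ⁻¹' E) ν := fun σ =>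
    hE.preimage (measurePreserving_swapPairs μ σ).quasiMeasurePreserving
  have h1 : ∑ σ : Fin m → Bool, ∫⁻ w, (swapPairs σ ⁻¹' E).indicator 1 w ∂ν = 2 ^ m * ν E := by
    have : ∀ σ : Fin m → Bool, ∫⁻ w, (swapPairs σ ⁻¹' E).indicator 1 w ∂ν = ν E := fun σ => by
      rw [lintegral_indicator_one₀ (hσ σ),
        (measurePreserving_swapPairs μ σ).measure_preimage hE]
    simp [this]
  have h2 : ∑ σ : Fin m → Bool, ∫⁻ w, (swapPairs σ ⁻¹' E).indicator 1 w ∂ν ≤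
      ENNReal.ofReal (N * (2 ^ m * (2 * Real.exp (-Λ)))) := by
    have hae : ∀ σ : Fin m → Bool,
        AEMeasurable ((swapPairs σ ⁻¹' E).indicator (1 : (Fin m → Z × Z) → ENNReal)) ν := fun σ =>
      (aemeasurable_const (b := (1 : ENNReal))).indicator₀ (hσ σ)
    rw [← lintegral_finsetSum' _ fun σ _ => hae σ]
    calc ∫⁻ w, ∑ σ : Fin m → Bool, (swapPairs σ ⁻¹' E).indicator 1 w ∂ν
        ≤ ∫⁻ _, ENNReal.ofReal (N * (2 ^ m * (2 * Real.exp (-Λ)))) ∂ν := by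
          refine lintegral_mono fun w => ?_
          have e : ∑ σ : Fin m → Bool, (swapPairs σ ⁻¹' E).indicator (1 : (Fin m → Z × Z) → ENNReal) w =
              ((Finset.univ.filter fun σ : Fin m → Bool => swapPairs σ w ∈ E).card : ENNReal) := by
            simp [Set.indicator_apply, Finset.sum_boole]
          rw [e, ← ENNReal.ofReal_natCast]
          exact ENNReal.ofReal_le_ofReal (card_swapPairs_mem_le hΛ w (hN w))
      _ = _ := by simp
  rw [h1] at h2
  have h3 : ENNReal.ofReal (N * (2 ^ m * (2 * Real.exp (-Λ)))) =
      2 ^ m * ENNReal.ofReal (2 * N * Real.exp (-Λ)) := by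
    rw [show (N : ℝ) * (2 ^ m * (2 * Real.exp (-Λ))) = 2 ^ m * (2 * N * Real.exp (-Λ)) by ring,
      ENNReal.ofReal_mul (by positivity), ENNReal.ofReal_pow (by norm_num)]
    simp
  rw [h3] at h2
  exact (ENNReal.mul_le_mul_iff_right (by simp) (by simp)).1 h2

theorem integral_count {m : ℕ} {A : Set Z} (hA : MeasurableSet A) :
    ∫ S, count S A ∂(Measure.pi fun _ : Fin m => μ) = m * μ.real A := by
  unfold count
  have h1 : Integrable (A.indicator fun _ => (1 : ℝ)) μ := (integrable_const _).indicator hA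
  have h3 : ∀ i : Fin m, Integrable (fun S : Fin m → Z => A.indicator (fun _ => (1 : ℝ)) (S i))
      (Measure.pi fun _ : Fin m => μ) := fun i =>
    (measurePreserving_eval (fun _ : Fin m => μ) i).integrable_comp_of_integrable h1
  rw [integral_finsetSum _ fun i _ => h3 i]
  have h2 : ∀ i : Fin m, ∫ S, A.indicator (fun _ => (1 : ℝ)) (S i)
      ∂(Measure.pi fun _ : Fin m => μ) = μ.real A := by
    intro i
    have := integral_map (measurePreserving_eval (fun _ : Fin m => μ) i).aemeasurable
      (f := A.indicator fun _ => (1 : ℝ))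
      (by rw [(measurePreserving_eval (fun _ : Fin m => μ) i).map_eq]; exact h1.1)
    rw [(measurePreserving_eval (fun _ : Fin m => μ) i).map_eq] at this
    rw [← integral_indicator_one hA]
    exact this.symm
  simp [h2]

theorem memLp_indicator_one {A : Set Z} (hA : MeasurableSet A) :
    MemLp (A.indicator fun _ => (1 : ℝ)) 2 μ :=
  memLp_indicator_const 2 hA 1 (Or.inr (measure_ne_top _ _))

theorem memLp_count {m : ℕ} {A : Set Z} (hA : MeasurableSet A) :
    MemLp (fun S : Fin m → Z => count S A) 2 (Measure.pi fun _ : Fin m => μ) := by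
  unfold count
  exact memLp_finsetSum _ fun i _ =>
    (memLp_indicator_one μ hA).comp_measurePreserving (measurePreserving_eval _ i)

theorem variance_count_le {m : ℕ} {A : Set Z} (hA : MeasurableSet A) :
    ProbabilityTheory.variance (fun S : Fin m → Z => count S A) (Measure.pi fun _ : Fin m => μ) ≤
      m * μ.real A := by
  have h := ProbabilityTheory.variance_sum_pi (μ := fun _ : Fin m => μ)
    (X := fun _ => A.indicator fun _ => (1 : ℝ)) (fun _ => memLp_indicator_one μ hA)
  have e : (fun S : Fin m → Z => count S A) =
      ∑ i, fun ω : Fin m → Z => A.indicator (fun _ => (1 : ℝ)) (ω i) := by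
    funext S
    simp [count]
  rw [e, h]
  have h2 : ProbabilityTheory.variance (A.indicator fun _ => (1 : ℝ)) μ ≤ μ.real A := by
    refine (ProbabilityTheory.variance_le_expectation_sq
      ((measurable_const.indicator hA).aestronglyMeasurable)).trans (le_of_eq ?_)
    rw [← integral_indicator_one hA]
    congr 1
    funext z
    by_cases hz : z ∈ A <;> simp [hz]
  simpa using mul_le_mul_of_nonneg_left h2 (Nat.cast_nonneg m)

/-- Chebyshev's inequality for the ghost sample: the variance is at most `m p`, and `2 / m ≤ u ^ 2`
makes the squared threshold at least twice as large. -/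
theorem half_le_measure_count_near {m : ℕ} (hm : 0 < m) {u : ℝ} (hu : 0 < u) (hu2 : 2 / m ≤ u ^ 2)
    {A : Set Z} (hA : MeasurableSet A) :
    1 / 2 ≤ (Measure.pi fun _ : Fin m => μ)
      {S | |count S A / m - μ.real A| < u * √(μ.real A) + u ^ 2} := by
  set p := μ.real A
  have hp : 0 ≤ p := measureReal_nonneg
  have hm' : (0 : ℝ) < m := by exact_mod_cast hm
  set c := u * √p + u ^ 2
  have hc : 0 < c := by positivity
  have h := ProbabilityTheory.meas_ge_le_variance_div_sq (memLp_count μ hA (m := m))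
    (c := m * c) (by positivity)
  rw [integral_count μ hA] at h
  have hset : {S : Fin m → Z | |count S A / m - p| < c} =
      {S | m * c ≤ |count S A - m * p|}ᶜ := by
    ext S
    simp only [Set.mem_ofPred_eq, Set.mem_compl_iff, not_le]
    have : count S A - m * p = m * (count S A / m - p) := by field_simp
    rw [this, abs_mul, abs_of_pos hm', mul_lt_mul_iff_right₀ hm']
  have hms : MeasurableSet {S : Fin m → Z | m * c ≤ |count S A - m * p|} :=
    measurableSet_le measurable_const ((measurable_count hA).sub_const _).abs
  rw [hset, prob_compl_eq_one_sub hms]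
  have hle : (Measure.pi fun _ : Fin m => μ) {S : Fin m → Z | m * c ≤ |count S A - m * p|} ≤
      1 / 2 := by
    refine h.trans ?_
    rw [show (1 / 2 : ENNReal) = ENNReal.ofReal (1 / 2) by
      rw [ENNReal.ofReal_div_of_pos (by norm_num)]; simp]
    refine ENNReal.ofReal_le_ofReal ?_
    rw [div_le_iff₀ (by positivity)]
    refine (variance_count_le μ hA).trans ?_
    have h1 : u ^ 2 * p ≤ c ^ 2 := by
      have : u ^ 2 * p = (u * √p) ^ 2 := by rw [mul_pow, Real.sq_sqrt hp]
      rw [this]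
      exact pow_le_pow_left₀ (by positivity) (by simp only [c]; nlinarith [sq_nonneg u]) 2
    have h2 : 2 / m * p ≤ u ^ 2 * p := mul_le_mul_of_nonneg_right hu2 hp
    have h3 : 2 / m * p ≤ c ^ 2 := h2.trans h1
    have h4 : (m : ℝ) ^ 2 * (2 / m * p) = 2 * (m * p) := by field_simp
    have h5 := mul_le_mul_of_nonneg_left h3 (sq_nonneg (m : ℝ))
    rw [h4] at h5
    nlinarith
  calc (1 / 2 : ENNReal) = 1 - 1 / 2 := by simp
    _ ≤ _ := tsub_le_tsub_left hle 1

/-- If one frequency is far from `p` and the ghost frequency is near, then they differ by more than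
`3 u √p + 15 u ^ 2`. This dominates the normalization by `x + x'`, in which `p` no longer occurs. -/
theorem sq_lt_of_deviation {x x' p u : ℝ} (hp : 0 ≤ p) (hu : 0 < u)
    (h1 : 4 * u * √p + 16 * u ^ 2 < |x - p|) (h2 : |x' - p| < u * √p + u ^ 2) :
    u ^ 2 * (x + x') < (x - x') ^ 2 := by
  set s := √p
  have hs : s ^ 2 = p := Real.sq_sqrt hp
  have hs0 : 0 ≤ s := Real.sqrt_nonneg _
  set D := |x - x'|
  have hD : 3 * u * s + 15 * u ^ 2 < D := by
    have : |x - p| ≤ D + |x' - p| := by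
      have := abs_add_le (x - x') (x' - p)
      simpa using this
    linarith
  have hx : x ≤ x' + D := by linarith [le_abs_self (x - x')]
  have hx' : x' ≤ p + (u * s + u ^ 2) := by linarith [le_abs_self (x' - p)]
  rw [← sq_abs (x - x')]
  change _ < D ^ 2
  have h3 : u ^ 2 * (x + x') ≤ u ^ 2 * (D + 2 * (p + (u * s + u ^ 2))) :=
    mul_le_mul_of_nonneg_left (by linarith) (by positivity)
  refine h3.trans_lt ?_
  have h4 : (3 * u * s + 15 * u ^ 2) * (3 * u * s + 14 * u ^ 2) < D * (D - u ^ 2) :=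
    mul_lt_mul'' hD (by linarith) (by positivity) (by positivity)
  have h5 : 0 < u ^ 4 := by positivity
  have h6 : 0 ≤ u ^ 3 * s := by positivity
  have h7 : 0 ≤ u ^ 2 * s ^ 2 := by positivity
  rw [← hs]
  nlinarith

/-- Uniform relative deviations of frequencies from probabilities over a class of sets. -/
theorem measure_exists_deviation_le {𝒞 : Set (Set Z)} {m N : ℕ} {u : ℝ} (hm : 0 < m) (hu : 0 < u)
    (hu2 : 2 / m ≤ u ^ 2) (hmeas : ∀ A ∈ 𝒞, MeasurableSet A)
    (hnull : ∀ p : Fin m → Bool × Bool, NullMeasurableSet {w | ∃ A ∈ 𝒞, pairPattern A w = p}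
      (Measure.pi fun _ : Fin m => μ.prod μ))
    (hN : ∀ w : Fin m → Z × Z, {p | ∃ A ∈ 𝒞, pairPattern A w = p}.ncard ≤ N) :
    (Measure.pi fun _ : Fin m => μ)
      {S | ∃ A ∈ 𝒞, 4 * u * √(μ.real A) + 16 * u ^ 2 < |count S A / m - μ.real A|} ≤
      ENNReal.ofReal (4 * N * Real.exp (-(m * u ^ 2 / 2))) := by
  have hm' : (0 : ℝ) < m := by exact_mod_cast hm
  set E := pairDeviation 𝒞 m (m * u ^ 2 / 2)
  have hE := measure_pairDeviation_le μ (Λ := m * u ^ 2 / 2) (by positivity) hnull hN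
  set ν := Measure.pi fun _ : Fin m => μ
  set e := MeasurableEquiv.arrowProdEquivProdArrow Z Z (Fin m)
  have he := measurePreserving_arrowProdEquivProdArrow Z Z (Fin m) (fun _ => μ) (fun _ => μ)
  -- The deviation event is only null measurable, while the sections used in the Markov argument
  -- require a measurable set; its hull has the same measure.
  set E' := toMeasurable (ν.prod ν) (e.symm ⁻¹' E)
  have hE' : (ν.prod ν) E' ≤ ENNReal.ofReal (2 * N * Real.exp (-(m * u ^ 2 / 2))) := by
    rw [measure_toMeasurable, (he.symm).measure_preimage_equiv]
    exact hE
  have hE'm : MeasurableSet E' := measurableSet_toMeasurable _ _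
  have hsub : {S | ∃ A ∈ 𝒞, 4 * u * √(μ.real A) + 16 * u ^ 2 < |count S A / m - μ.real A|} ⊆
      {S | 1 / 2 ≤ ν (Prod.mk S ⁻¹' E')} := by
    rintro S ⟨A, hA, hS⟩
    refine (half_le_measure_count_near μ hm hu hu2 (hmeas A hA)).trans (measure_mono ?_)
    intro S' hS'
    refine subset_toMeasurable _ _ ?_
    refine ⟨A, hA, ?_⟩
    have h := sq_lt_of_deviation measureReal_nonneg hu hS hS'
    change 2 * (m * u ^ 2 / 2) * (count S A + count S' A) < (count S A - count S' A) ^ 2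
    have e1 : 2 * (m * u ^ 2 / 2) * (count S A + count S' A) =
        m ^ 2 * (u ^ 2 * (count S A / m + count S' A / m)) := by field_simp
    have e2 : (count S A - count S' A) ^ 2 = m ^ 2 * (count S A / m - count S' A / m) ^ 2 := by
      field_simp
    rw [e1, e2]
    exact mul_lt_mul_of_pos_left h (by positivity)
  have hmk := mul_meas_ge_le_lintegral (μ := ν) (measurable_measure_prodMk_left (ν := ν) hE'm)
    (1 / 2)
  rw [← Measure.prod_apply hE'm] at hmk
  have h2 : ν {S | 1 / 2 ≤ ν (Prod.mk S ⁻¹' E')} ≤ 2 * (ν.prod ν) E' := by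
    have := mul_le_mul_right hmk 2
    rw [← mul_assoc] at this
    have e2 : (2 : ENNReal) * (1 / 2) = 1 := by
      rw [one_div]; exact ENNReal.mul_inv_cancel (by simp) (by simp)
    rwa [e2, one_mul] at this
  calc ν {S | ∃ A ∈ 𝒞, 4 * u * √(μ.real A) + 16 * u ^ 2 < |count S A / m - μ.real A|}
      ≤ 2 * (ν.prod ν) E' := (measure_mono hsub).trans h2
    _ ≤ 2 * ENNReal.ofReal (2 * N * Real.exp (-(m * u ^ 2 / 2))) := by gcongr
    _ = ENNReal.ofReal (4 * N * Real.exp (-(m * u ^ 2 / 2))) := by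
      rw [show (4 : ℝ) * N * Real.exp (-(m * u ^ 2 / 2)) =
        2 * (2 * N * Real.exp (-(m * u ^ 2 / 2))) by ring, ENNReal.ofReal_mul (by norm_num)]
      simp

end Symmetrization

/-! ### Elementary properties of the confidence levels and deviation scales -/

section Scales

theorem one_le_logb_two_mul {m : ℕ} (hm : 1 ≤ m) : 1 ≤ Real.logb 2 (2 * m) := by
  have : (1 : ℝ) ≤ m := by exact_mod_cast hm
  rw [Real.le_logb_iff_rpow_le (by norm_num) (by positivity)]
  simpa using this

theorem confidence_pos {δ : ℝ} (hδ : 0 < δ) {m : ℕ} (hm : 1 ≤ m) : 0 < confidence δ m := by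
  have := one_le_logb_two_mul hm
  unfold confidence
  positivity

theorem confidence_le {δ : ℝ} (hδ : 0 < δ) {m : ℕ} (hm : 1 ≤ m) : confidence δ m ≤ δ := by
  have := one_le_logb_two_mul hm
  exact div_le_self hδ.le (one_le_pow₀ this)

theorem log_two_le_log_confidence {δ : ℝ} (hδ : 0 < δ) (hδ2 : δ < 1 / 2) {m : ℕ} (hm : 1 ≤ m) :
    Real.log 2 ≤ Real.log (1 / confidence δ m) := by
  have h1 := confidence_pos hδ hm
  have h2 := confidence_le hδ hm
  refine Real.log_le_log (by norm_num) ?_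
  rw [le_div_iff₀ h1]
  linarith

theorem le_capacity {d : ℕ} (hd : 1 ≤ d) (m : ℕ) :
    (d : ℝ) ≤ d * Real.log (Real.exp 1 * max (m : ℝ) d / d) := by
  have hd' : (0 : ℝ) < d := by exact_mod_cast hd
  refine le_mul_of_one_le_right hd'.le ?_
  rw [Real.le_log_iff_exp_le (by positivity), le_div_iff₀ hd']
  exact mul_le_mul_of_nonneg_left (le_max_right _ _) (Real.exp_pos _).le

theorem capacity_nonneg (d m : ℕ) :
    0 ≤ (d : ℝ) * Real.log (Real.exp 1 * max (m : ℝ) d / d) := by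
  rcases Nat.eq_zero_or_pos d with rfl | hd
  · simp
  · exact (Nat.cast_nonneg d).trans (le_capacity hd m)

theorem mul_deviationScale (d : ℕ) (δ : ℝ) {m : ℕ} (hm : 1 ≤ m) :
    m * deviationScale d δ m = 1024 * (d * Real.log (Real.exp 1 * max (m : ℝ) d / d) +
      Real.log (1 / confidence δ m)) := by
  have : (m : ℝ) ≠ 0 := by exact_mod_cast (by omega : m ≠ 0)
  unfold deviationScale
  field_simp

theorem deviationScale_pos (d : ℕ) {δ : ℝ} (hδ : 0 < δ) (hδ2 : δ < 1 / 2) {m : ℕ} (hm : 1 ≤ m) :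
    0 < deviationScale d δ m := by
  have h1 := mul_deviationScale d δ hm
  have h2 := log_two_le_log_confidence hδ hδ2 hm
  have h3 := capacity_nonneg d m
  have h4 := Real.log_pos (by norm_num : (1 : ℝ) < 2)
  have h5 : (0 : ℝ) < m := by exact_mod_cast hm
  have : 0 < m * deviationScale d δ m := by rw [h1]; linarith
  exact pos_of_mul_pos_right this h5.le

/-- A double sample has `2 * m` points, whence the extra `d * log 2`. Enlarging `m` to `max m d`
covers samples smaller than the VC dimension. -/
theorem sum_choose_le_exp_capacity {d : ℕ} (hd : 1 ≤ d) (m : ℕ) :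
    ((∑ k ∈ Finset.Iic d, (2 * m).choose k : ℕ) : ℝ) ≤
      Real.exp (d * Real.log 2 + d * Real.log (Real.exp 1 * max (m : ℝ) d / d)) := by
  have hd' : (0 : ℝ) < d := by exact_mod_cast hd
  have h1 : ∑ k ∈ Finset.Iic d, (2 * m).choose k ≤
      ∑ k ∈ Finset.Iic d, (2 * max m d).choose k :=
    Finset.sum_le_sum fun k _ => Nat.choose_le_choose _ (by have := le_max_left m d; omega)
  have h2 := sum_choose_le_exp_mul hd (n := 2 * max m d) (by have := le_max_right m d; omega)
  refine ((Nat.cast_le (α := ℝ)).2 h1).trans (h2.trans (le_of_eq ?_))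
  have hM : (0 : ℝ) < max (m : ℝ) d := lt_max_of_lt_right hd'
  rw [← mul_add, ← Real.log_mul (by norm_num) (by positivity), Real.exp_nat_mul,
    Real.exp_log (by positivity)]
  push_cast
  ring

end Scales

/-! ### Concentration of the error differences between members of the class -/

section Errors

variable {X : Type*}

/-- The labeled points on which `f` errs and `g` does not. -/
def errorDiff (f g : X → Bool) : Set (X × Bool) := {z | f z.1 ≠ z.2 ∧ g z.1 = z.2}

/-- The sets of labeled points on which one member of `F` errs and another one does not. -/
def errorDiffs (F : Set (X → Bool)) : Set (Set (X × Bool)) :=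
  {A | ∃ f ∈ F, ∃ g ∈ F, A = errorDiff f g}

/-- The instances in a double sample. -/
def pairPoints {m : ℕ} (w : Fin m → (X × Bool) × (X × Bool)) : Fin m ⊕ Fin m → X :=
  Sum.elim (fun i => (w i).1.1) fun i => (w i).2.1

/-- The labels in a double sample. -/
def pairLabels {m : ℕ} (w : Fin m → (X × Bool) × (X × Bool)) : Fin m ⊕ Fin m → Bool :=
  Sum.elim (fun i => (w i).1.2) fun i => (w i).2.2

/-- The pattern of an error difference in terms of predictions and labels. -/
def errorDiffPattern {m : ℕ} (q r y : Fin m ⊕ Fin m → Bool) : Fin m → Bool × Bool :=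
  fun i => (decide (q (.inl i) ≠ y (.inl i) ∧ r (.inl i) = y (.inl i)),
    decide (q (.inr i) ≠ y (.inr i) ∧ r (.inr i) = y (.inr i)))

theorem exists_pairPattern_errorDiffs_iff {F : Set (X → Bool)} {m : ℕ}
    (w : Fin m → (X × Bool) × (X × Bool)) (p : Fin m → Bool × Bool) :
    (∃ A ∈ errorDiffs F, pairPattern A w = p) ↔ ∃ q r : Fin m ⊕ Fin m → Bool,
      (∃ f ∈ F, ∀ i, f (pairPoints w i) = q i) ∧ (∃ g ∈ F, ∀ i, g (pairPoints w i) = r i) ∧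
        errorDiffPattern q r (pairLabels w) = p := by
  have key : ∀ f g : X → Bool, pairPattern (errorDiff f g) w =
      errorDiffPattern (fun i => f (pairPoints w i)) (fun i => g (pairPoints w i))
        (pairLabels w) := by
    intro f g
    funext i
    simp only [pairPattern, errorDiffPattern, errorDiff, pairPoints, pairLabels, Sum.elim_inl,
      Sum.elim_inr, Set.mem_ofPred_eq]
    congr
  constructor
  · rintro ⟨_, ⟨f, hf, g, hg, rfl⟩, rfl⟩
    exact ⟨_, _, ⟨f, hf, fun _ => rfl⟩, ⟨g, hg, fun _ => rfl⟩, (key f g).symm⟩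
  · rintro ⟨q, r, ⟨f, hf, hfq⟩, ⟨g, hg, hgr⟩, rfl⟩
    obtain rfl : (fun i => f (pairPoints w i)) = q := funext hfq
    obtain rfl : (fun i => g (pairPoints w i)) = r := funext hgr
    exact ⟨_, ⟨f, hf, g, hg, rfl⟩, key f g⟩

/-- For given labels the pattern is determined by the traces of the two classifiers on the `2 * m`
instances, which accounts for the square. -/
theorem ncard_pairPattern_errorDiffs_le {F : Set (X → Bool)} {d : ℕ} (hF : HasVCDim F d) {m : ℕ}
    (w : Fin m → (X × Bool) × (X × Bool)) :
    {p | ∃ A ∈ errorDiffs F, pairPattern A w = p}.ncard ≤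
      (∑ k ∈ Finset.Iic d, (2 * m).choose k) ^ 2 := by
  have h := ncard_trace_le hF (pairPoints w)
  set T := {p : Fin m ⊕ Fin m → Bool | ∃ f ∈ F, ∀ i, f (pairPoints w i) = p i}
  have hsub : {p | ∃ A ∈ errorDiffs F, pairPattern A w = p} ⊆
      (fun qr : (Fin m ⊕ Fin m → Bool) × (Fin m ⊕ Fin m → Bool) =>
        errorDiffPattern qr.1 qr.2 (pairLabels w)) '' (T ×ˢ T) := by
    intro p hp
    obtain ⟨q, r, hq, hr, h⟩ := (exists_pairPattern_errorDiffs_iff w p).1 hp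
    exact ⟨(q, r), ⟨hq, hr⟩, h⟩
  have h2 : Fintype.card (Fin m ⊕ Fin m) = 2 * m := by simp; ring
  rw [h2] at h
  calc _ ≤ _ := Set.ncard_le_ncard hsub (Set.toFinite _)
    _ ≤ (T ×ˢ T).ncard := Set.ncard_image_le (Set.toFinite _)
    _ = T.ncard ^ 2 := by rw [Set.ncard_prod, sq]
    _ ≤ _ := Nat.pow_le_pow_left h 2

variable [MeasurableSpace X] {P : Measure (X × Bool)} [IsProbabilityMeasure P]

theorem measurableSet_errorDiff {f g : X → Bool} (hf : Measurable f) (hg : Measurable g) :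
    MeasurableSet (errorDiff f g) := by
  have h1 : MeasurableSet {z : X × Bool | f z.1 = z.2} :=
    measurableSet_eq_fun (hf.comp measurable_fst) measurable_snd
  have h2 : MeasurableSet {z : X × Bool | g z.1 = z.2} :=
    measurableSet_eq_fun (hg.comp measurable_fst) measurable_snd
  exact h1.compl.inter h2

theorem MeasurableClass.nullMeasurable_trace_fintype {F : Set (X → Bool)}
    (hF : MeasurableClass P F) {ι : Type*} [Fintype ι] (p : ι → Bool) :
    NullMeasurableSet {x : ι → X | ∃ f ∈ F, ∀ i, f (x i) = p i}
      (Measure.pi fun _ : ι => P.fst) := by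
  let e := Fintype.equivFin ι
  have h := hF.nullMeasurable_trace (Fintype.card ι) (p ∘ e.symm)
  have hmp := measurePreserving_piCongrLeft (α := fun _ : Fin (Fintype.card ι) => X)
    (fun _ => P.fst) e
  have h2 := h.preimage hmp.quasiMeasurePreserving
  convert! h2 using 1
  ext x
  simp only [Set.mem_ofPred_eq, Set.mem_preimage]
  have hx : ∀ i, MeasurableEquiv.piCongrLeft (fun _ : Fin (Fintype.card ι) => X) e x (e i) = x i :=
    fun i => by simp [MeasurableEquiv.coe_piCongrLeft, Equiv.piCongrLeft_apply_apply]
  refine exists_congr fun f => and_congr_right fun _ => ?_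
  constructor
  · intro h i
    obtain ⟨j, rfl⟩ := e.surjective i
    rw [hx]
    simpa using h j
  · intro h i
    have := h (e i)
    rw [hx] at this
    simpa using this

theorem measurePreserving_pairPoints (m : ℕ) :
    MeasurePreserving (pairPoints (X := X) (m := m)) (Measure.pi fun _ : Fin m => P.prod P)
      (Measure.pi fun _ : Fin m ⊕ Fin m => P.fst) := by
  have h1 := measurePreserving_arrowProdEquivProdArrow (X × Bool) (X × Bool) (Fin m)
    (fun _ => P) (fun _ => P)
  have h2 := measurePreserving_sumPiEquivProdPi_symm (X := fun _ : Fin m ⊕ Fin m => X × Bool)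
    (fun _ => P)
  have hfst : MeasurePreserving (Prod.fst : X × Bool → X) P P.fst := ⟨measurable_fst, rfl⟩
  have h3 := measurePreserving_pi (fun _ : Fin m ⊕ Fin m => P) (fun _ => P.fst)
    (f := fun _ => Prod.fst) fun _ => hfst
  have h4 := h3.comp (h2.comp h1)
  convert! h4 using 1
  funext w i
  rcases i with i | i <;> rfl

theorem measurable_pairLabels (m : ℕ) : Measurable (pairLabels (X := X) (m := m)) := by
  refine measurable_pi_lambda _ fun i => ?_
  rcases i with i | i
  · exact measurable_snd.comp (measurable_fst.comp (measurable_pi_apply i))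
  · exact measurable_snd.comp (measurable_snd.comp (measurable_pi_apply i))

theorem nullMeasurableSet_pairPattern_errorDiffs {F : Set (X → Bool)} (hF : MeasurableClass P F)
    {m : ℕ} (p : Fin m → Bool × Bool) :
    NullMeasurableSet {w | ∃ A ∈ errorDiffs F, pairPattern A w = p}
      (Measure.pi fun _ : Fin m => P.prod P) := by
  have hT : ∀ q : Fin m ⊕ Fin m → Bool, NullMeasurableSet
      {w : Fin m → (X × Bool) × (X × Bool) | ∃ f ∈ F, ∀ i, f (pairPoints w i) = q i}
      (Measure.pi fun _ : Fin m => P.prod P) := fun q =>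
    (hF.nullMeasurable_trace_fintype q).preimage
      (measurePreserving_pairPoints m).quasiMeasurePreserving
  have hset : {w | ∃ A ∈ errorDiffs F, pairPattern A w = p} =
      ⋃ q : Fin m ⊕ Fin m → Bool, ⋃ r : Fin m ⊕ Fin m → Bool,
        ({w | ∃ f ∈ F, ∀ i, f (pairPoints w i) = q i} ∩
          ({w | ∃ f ∈ F, ∀ i, f (pairPoints w i) = r i} ∩
            pairLabels ⁻¹' {y | errorDiffPattern q r y = p})) := by
    ext w
    simp only [Set.mem_ofPred_eq, exists_pairPattern_errorDiffs_iff, Set.mem_iUnion,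
      Set.mem_inter_iff, Set.mem_preimage]
  rw [hset]
  refine NullMeasurableSet.iUnion fun q => NullMeasurableSet.iUnion fun r => ?_
  exact (hT q).inter ((hT r).inter
    ((measurable_pairLabels m) (Set.toFinite _).measurableSet).nullMeasurableSet)

/-- On the sample, the frequencies of all error differences between members of `F` are close to
their probabilities, on the scale `e`. -/
def Concentrated (P : Measure (X × Bool)) (F : Set (X → Bool)) (e : ℝ) {m : ℕ}
    (S : Fin m → X × Bool) : Prop :=
  ∀ f ∈ F, ∀ g ∈ F, |count S (errorDiff f g) / m - P.real (errorDiff f g)| ≤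
    4 * √(e / 100) * √(P.real (errorDiff f g)) + 16 * (e / 100)

theorem measure_not_concentrated_le {F : Set (X → Bool)} {d : ℕ} (hF : MeasurableClass P F)
    (hd : HasVCDim F d) (hd1 : 1 ≤ d) {δ : ℝ} (hδ : 0 < δ) (hδ2 : δ < 1 / 2) {m : ℕ}
    (hm : 1 ≤ m) :
    (Measure.pi fun _ : Fin m => P) {S | ¬ Concentrated P F (deviationScale d δ m) S} ≤
      ENNReal.ofReal (confidence δ m / 8) := by
  have hm' : (0 : ℝ) < m := by exact_mod_cast hm
  have hd' : (1 : ℝ) ≤ d := by exact_mod_cast hd1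
  set e := deviationScale d δ m
  have he : 0 < e := deviationScale_pos d hδ hδ2 hm
  have hme := mul_deviationScale d δ hm
  set D := (d : ℝ) * Real.log (Real.exp 1 * max (m : ℝ) d / d)
  set l := Real.log (1 / confidence δ m)
  have hD : (d : ℝ) ≤ D := le_capacity hd1 m
  have hl : Real.log 2 ≤ l := log_two_le_log_confidence hδ hδ2 hm
  have hlog1 := Real.log_two_gt_d9
  have hlog2 := Real.log_two_lt_d9
  have hsq : √(e / 100) ^ 2 = e / 100 := Real.sq_sqrt (by positivity)
  have hu2 : 2 / m ≤ √(e / 100) ^ 2 := by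
    rw [hsq, div_le_iff₀ hm']
    change (m : ℝ) * e = _ at hme
    nlinarith
  have h := measure_exists_deviation_le P (𝒞 := errorDiffs F) (u := √(e / 100)) hm
    (Real.sqrt_pos.2 (by positivity)) hu2
    (by
      rintro _ ⟨f, hf, g, hg, rfl⟩
      exact measurableSet_errorDiff (hF.measurable f hf) (hF.measurable g hg))
    (nullMeasurableSet_pairPattern_errorDiffs hF)
    (ncard_pairPattern_errorDiffs_le hd)
  have hset : {S : Fin m → X × Bool | ¬ Concentrated P F e S} =
      {S | ∃ A ∈ errorDiffs F, 4 * √(e / 100) * √(P.real A) + 16 * √(e / 100) ^ 2 <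
        |count S A / m - P.real A|} := by
    ext S
    simp only [Concentrated, Set.mem_ofPred_eq, not_forall, not_le, hsq]
    constructor
    · rintro ⟨f, hf, g, hg, h⟩
      exact ⟨_, ⟨f, hf, g, hg, rfl⟩, h⟩
    · rintro ⟨_, ⟨f, hf, g, hg, rfl⟩, h⟩
      exact ⟨f, hf, g, hg, h⟩
  rw [hset]
  refine h.trans (ENNReal.ofReal_le_ofReal ?_)
  have hS := sum_choose_le_exp_capacity hd1 m
  have hc : confidence δ m = Real.exp (-l) := by
    simp only [l]
    rw [one_div, Real.log_inv, neg_neg, Real.exp_log (confidence_pos hδ hm)]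
  have h32 : (32 : ℝ) = Real.exp (5 * Real.log 2) := by
    rw [show (5 : ℝ) * Real.log 2 = ((5 : ℕ) : ℝ) * Real.log 2 by norm_num, Real.exp_nat_mul,
      Real.exp_log (by norm_num)]
    norm_num
  have hNle : (((∑ k ∈ Finset.Iic d, (2 * m).choose k) ^ 2 : ℕ) : ℝ) ≤
      Real.exp (2 * (d * Real.log 2 + D)) := by
    rw [Nat.cast_pow, show (2 : ℝ) * (d * Real.log 2 + D) = ((2 : ℕ) : ℝ) * (d * Real.log 2 + D)
      by norm_num, Real.exp_nat_mul]
    exact pow_le_pow_left₀ (by positivity) hS 2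
  -- The factor `32 = 4 * 8` collects the constant of the deviation inequality and the claimed `1 /
  -- 8`. With `u ^ 2 = e / 100` the exponent `m * u ^ 2 / 2` equals `5.12 * (D + l)`, which pays for
  -- all terms.
  have hexp : Real.exp (5 * Real.log 2) * (Real.exp (2 * (d * Real.log 2 + D)) *
      Real.exp (-(m * √(e / 100) ^ 2 / 2))) ≤ Real.exp (-l) := by
    rw [← Real.exp_add, ← Real.exp_add]
    refine Real.exp_le_exp.2 ?_
    rw [hsq]
    have e1 : m * (e / 100) / 2 = (m * e) / 200 := by ring
    rw [e1]
    change (m : ℝ) * e = _ at hme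
    rw [hme]
    have : (d : ℝ) * Real.log 2 ≤ D * 0.7 := by nlinarith
    linarith
  rw [hc]
  have h3 : (((∑ k ∈ Finset.Iic d, (2 * m).choose k) ^ 2 : ℕ) : ℝ) *
      Real.exp (-(m * √(e / 100) ^ 2 / 2)) ≤ Real.exp (2 * (d * Real.log 2 + D)) *
      Real.exp (-(m * √(e / 100) ^ 2 / 2)) :=
    mul_le_mul_of_nonneg_right hNle (Real.exp_pos _).le
  rw [← h32] at hexp
  linarith

end Errors

/-! ### Covering the disagreement region by version space compression -/

section Disagreement

variable {X : Type*}

theorem agnosticVersionSpace_eq_univ_iff {m : ℕ} {F : Set (X → Bool)} {S : Fin m → X × Bool}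
    {fstar : X → Bool} {C : Finset (Fin m)} :
    agnosticVersionSpace F S fstar C = agnosticVersionSpace F S fstar Finset.univ ↔
      ¬ ∃ f ∈ F, (∀ i ∈ C, f (S i).1 = fstar (S i).1) ∧ ∃ i, f (S i).1 ≠ fstar (S i).1 := by
  constructor
  · rintro h ⟨f, hf, hC, i, hi⟩
    have : f ∈ agnosticVersionSpace F S fstar C := ⟨hf, hC⟩
    rw [h] at this
    exact hi (this.2 i (Finset.mem_univ i))
  · intro h
    ext f
    constructor
    · rintro ⟨hf, hC⟩
      refine ⟨hf, fun i _ => ?_⟩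
      by_contra hi
      exact h ⟨f, hf, hC, i, hi⟩
    · rintro ⟨hf, hC⟩
      exact ⟨hf, fun i _ => hC i (Finset.mem_univ i)⟩

theorem exists_card_eq_compressionSize {m : ℕ} (F : Set (X → Bool)) (S : Fin m → X × Bool)
    (fstar : X → Bool) : ∃ C : Finset (Fin m), C.card = compressionSize F S fstar ∧
      agnosticVersionSpace F S fstar C = agnosticVersionSpace F S fstar Finset.univ :=
  Nat.sInf_mem (s := {k | ∃ C : Finset (Fin m), C.card = k ∧
    agnosticVersionSpace F S fstar C = agnosticVersionSpace F S fstar Finset.univ})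
    ⟨_, Finset.univ, rfl, rfl⟩

theorem compressionSize_le_iff {m : ℕ} {F : Set (X → Bool)} {S : Fin m → X × Bool}
    {fstar : X → Bool} {b : ℕ} : compressionSize F S fstar ≤ b ↔
      ∃ C : Finset (Fin m), C.card ≤ b ∧
        agnosticVersionSpace F S fstar C = agnosticVersionSpace F S fstar Finset.univ := by
  constructor
  · intro h
    obtain ⟨C, hC, hC2⟩ := exists_card_eq_compressionSize F S fstar
    exact ⟨C, hC.le.trans h, hC2⟩
  · rintro ⟨C, hC, hC2⟩
    refine le_trans (Nat.sInf_le ?_) hC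
    exact ⟨C, rfl, hC2⟩

/-- Pairs of an instance and a sample such that agreement with `fstar` on the sample does not
determine the value at the instance. -/
def disagreementPairs (F : Set (X → Bool)) (fstar : X → Bool) (k : ℕ) :
    Set ((X × Bool) × (Fin k → X × Bool)) :=
  {w | ∃ f ∈ F, (∀ j, f (w.2 j).1 = fstar (w.2 j).1) ∧ f w.1.1 ≠ fstar w.1.1}

/-- An index whose value is not forced by all the others cannot be omitted from any subsample
inducing the full version space. -/
theorem card_essential_le_compressionSize {k : ℕ} (F : Set (X → Bool))
    (S : Fin (k + 1) → X × Bool) (fstar : X → Bool) (I : Finset (Fin (k + 1)))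
    (hI : ∀ i ∈ I, (S i, fun j => S (i.succAbove j)) ∈ disagreementPairs F fstar k) :
    I.card ≤ compressionSize F S fstar := by
  obtain ⟨C, hC, hC2⟩ := exists_card_eq_compressionSize F S fstar
  rw [← hC]
  refine Finset.card_le_card fun i hi => ?_
  by_contra hiC
  obtain ⟨f, hf, h1, h2⟩ := hI i hi
  refine agnosticVersionSpace_eq_univ_iff.1 hC2 ⟨f, hf, fun j hj => ?_, i, h2⟩
  obtain ⟨j', rfl⟩ := Fin.exists_succAbove_eq (x := j) (y := i) (fun h => hiC (h ▸ hj))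
  exact h1 j'

variable [MeasurableSpace X] {P : Measure (X × Bool)} [IsProbabilityMeasure P]

/-- There are finitely many label patterns, so every event that depends only on the traces of `F`
and `fstar` is a finite union of sets covered by the measurability condition. -/
theorem nullMeasurableSet_exists_trace {F : Set (X → Bool)} (hF : MeasurableClass P F)
    {fstar : X → Bool} (hfs : Measurable fstar) {m : ℕ}
    (R : (Fin m → Bool) → (Fin m → Bool) → Prop) :
    NullMeasurableSet {S : Fin m → X × Bool | ∃ f ∈ F, R (fun i => f (S i).1)
      fun i => fstar (S i).1} (Measure.pi fun _ : Fin m => P) := by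
  have hfst : MeasurePreserving (Prod.fst : X × Bool → X) P P.fst := ⟨measurable_fst, rfl⟩
  have hmp := measurePreserving_pi (fun _ : Fin m => P) (fun _ => P.fst)
    (f := fun _ => Prod.fst) fun _ => hfst
  have hset : {S : Fin m → X × Bool | ∃ f ∈ F, R (fun i => f (S i).1) fun i => fstar (S i).1} =
      ⋃ p : Fin m → Bool, ((fun (S : Fin m → X × Bool) i => (S i).1) ⁻¹'
        {x | ∃ f ∈ F, ∀ i, f (x i) = p i} ∩
        (fun (S : Fin m → X × Bool) i => fstar (S i).1) ⁻¹' {y | R p y}) := by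
    ext S
    simp only [Set.mem_ofPred_eq, Set.mem_iUnion, Set.mem_inter_iff, Set.mem_preimage]
    constructor
    · rintro ⟨f, hf, h⟩
      exact ⟨_, ⟨f, hf, fun _ => rfl⟩, h⟩
    · rintro ⟨p, ⟨f, hf, hp⟩, h⟩
      obtain rfl : (fun i => f (S i).1) = p := funext hp
      exact ⟨f, hf, h⟩
  rw [hset]
  refine NullMeasurableSet.iUnion fun p => NullMeasurableSet.inter
    ((hF.nullMeasurable_trace m p).preimage hmp.quasiMeasurePreserving) ?_
  have hm : Measurable fun (S : Fin m → X × Bool) i => fstar (S i).1 :=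
    measurable_pi_lambda _ fun i => hfs.comp (measurable_fst.comp (measurable_pi_apply i))
  exact (hm (Set.toFinite _).measurableSet).nullMeasurableSet

theorem nullMeasurableSet_compressionSize_le {F : Set (X → Bool)} (hF : MeasurableClass P F)
    {fstar : X → Bool} (hfs : Measurable fstar) (m b : ℕ) :
    NullMeasurableSet {S : Fin m → X × Bool | compressionSize F S fstar ≤ b}
      (Measure.pi fun _ : Fin m => P) := by
  have hset : {S : Fin m → X × Bool | compressionSize F S fstar ≤ b} =
      ⋃ C ∈ {C : Finset (Fin m) | C.card ≤ b}, {S : Fin m → X × Bool | ∃ f ∈ F,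
        (∀ i ∈ C, f (S i).1 = fstar (S i).1) ∧ ∃ i, f (S i).1 ≠ fstar (S i).1}ᶜ := by
    ext S
    simp only [Set.mem_ofPred_eq, compressionSize_le_iff, agnosticVersionSpace_eq_univ_iff,
      Set.mem_iUnion, Set.mem_compl_iff, exists_prop]
  rw [hset]
  refine NullMeasurableSet.biUnion (Set.to_countable _) fun C _ => NullMeasurableSet.compl ?_
  exact nullMeasurableSet_exists_trace hF hfs
    fun p y => (∀ i ∈ C, p i = y i) ∧ ∃ i, p i ≠ y i

theorem compressionBound_spec (F : Set (X → Bool)) (fstar : X → Bool) (m : ℕ) {η : ℝ}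
    (hη : 0 ≤ η) : 1 - η ≤ (Measure.pi fun _ : Fin m => P).real
      {S | compressionSize F S fstar ≤ compressionBound P F fstar m η} := by
  refine Nat.sInf_mem (s := {b | 1 - η ≤ (Measure.pi fun _ : Fin m => P).real
    {S | compressionSize F S fstar ≤ b}}) ⟨m, ?_⟩
  have : {S : Fin m → X × Bool | compressionSize F S fstar ≤ m} = Set.univ := by
    refine Set.eq_univ_of_forall fun S => compressionSize_le_iff.2 ⟨Finset.univ, by simp, rfl⟩
  simp only [Set.mem_ofPred_eq, this, probReal_univ]
  linarith

theorem compressionBound_le (F : Set (X → Bool)) (fstar : X → Bool) (m : ℕ) {η : ℝ}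
    (hη : 0 ≤ η) : compressionBound P F fstar m η ≤ m := by
  refine Nat.sInf_le ?_
  have : {S : Fin m → X × Bool | compressionSize F S fstar ≤ m} = Set.univ := by
    refine Set.eq_univ_of_forall fun S => compressionSize_le_iff.2 ⟨Finset.univ, by simp, rfl⟩
  simp only [Set.mem_ofPred_eq, this, probReal_univ]
  linarith

theorem compressionBound_le_max (F : Set (X → Bool)) (fstar : X → Bool) {r₀ r : ℝ}
    (hr₀ : 0 < r₀) (hr : r₀ < r) :
    compressionBound P F fstar ⌈1 / r⌉₊ (1 / 20) ≤ maxCompressionBound P F fstar r₀ := by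
  refine le_csSup ⟨⌈1 / r₀⌉₊, ?_⟩ ⟨r, hr, rfl⟩
  rintro _ ⟨r', hr', rfl⟩
  exact (compressionBound_le F fstar _ (by norm_num)).trans
    (Nat.ceil_le_ceil (one_div_le_one_div_of_le hr₀ hr'.le))

theorem nullMeasurableSet_disagreementPairs {F : Set (X → Bool)} (hF : MeasurableClass P F)
    {fstar : X → Bool} (hfs : Measurable fstar) (k : ℕ) :
    NullMeasurableSet (disagreementPairs F fstar k)
      (P.prod (Measure.pi fun _ : Fin k => P)) := by
  have h := nullMeasurableSet_exists_trace hF hfs (m := k + 1)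
    fun p y => (∀ j : Fin k, p ((0 : Fin (k + 1)).succAbove j) = y ((0 : Fin (k + 1)).succAbove j)) ∧
      p 0 ≠ y 0
  have hmp := measurePreserving_piFinSuccAbove (fun _ : Fin (k + 1) => P) 0
  have h2 := h.preimage hmp.symm.quasiMeasurePreserving
  convert! h2 using 1

theorem three_quarters_le_measure_agree {f fstar : X → Bool} (hf : Measurable f)
    (hfs : Measurable fstar) {r : ℝ} {k : ℕ} (hk : k * r ≤ 1)
    (h : disagreeProb P f fstar ≤ r / 4) :
    3 / 4 ≤ (Measure.pi fun _ : Fin k => P) {S | ∀ j, f (S j).1 = fstar (S j).1} := by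
  have hms : MeasurableSet {z : X × Bool | f z.1 ≠ fstar z.1} :=
    (measurableSet_eq_fun (hf.comp measurable_fst) (hfs.comp measurable_fst)).compl
  set q := disagreeProb P f fstar
  have hq0 : 0 ≤ q := measureReal_nonneg
  have hq1 : q ≤ 1 := measureReal_le_one
  have hset : {S : Fin k → X × Bool | ∀ j, f (S j).1 = fstar (S j).1} =
      Set.pi Set.univ fun _ => {z : X × Bool | f z.1 ≠ fstar z.1}ᶜ := by
    ext S; simp [Set.mem_pi]
  have hP : P {z : X × Bool | f z.1 ≠ fstar z.1}ᶜ = ENNReal.ofReal (1 - q) := by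
    rw [← ofReal_measureReal, probReal_compl_eq_one_sub hms]
    rfl
  rw [hset, Measure.pi_pi]
  simp only [hP, Finset.prod_const, Finset.card_univ, Fintype.card_fin]
  rw [← ENNReal.ofReal_pow (by linarith)]
  have h34 : (3 / 4 : ENNReal) = ENNReal.ofReal (3 / 4) := by
    rw [ENNReal.ofReal_div_of_pos (by norm_num)]; simp
  rw [h34]
  refine ENNReal.ofReal_le_ofReal ?_
  have hb := one_add_mul_le_pow (a := -q) (by linarith) k
  have : (k : ℝ) * q ≤ k * (r / 4) := mul_le_mul_of_nonneg_left h (Nat.cast_nonneg k)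
  calc (3 / 4 : ℝ) ≤ 1 + k * -q := by linarith
    _ ≤ (1 + -q) ^ k := hb
    _ = (1 - q) ^ k := by ring

/-- If the version space compression set size is small with large probability, then all
classifiers near `fstar` differ from it only on a set of small probability. -/
theorem exists_disagreement_cover {F : Set (X → Bool)} (hF : MeasurableClass P F)
    {fstar : X → Bool} (hfs : Measurable fstar) {r : ℝ} (hr : 0 < r) :
    ∃ W : Set (X × Bool), MeasurableSet W ∧
      P.real W ≤ 3 * (compressionBound P F fstar ⌈1 / r⌉₊ (1 / 20) + 1) * r ∧
      ∀ f ∈ F, disagreeProb P f fstar ≤ r / 4 → ∀ z : X × Bool, f z.1 ≠ fstar z.1 → z ∈ W := by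
  classical
  obtain ⟨k, hk⟩ : ∃ k, ⌈1 / r⌉₊ = k + 1 :=
    Nat.exists_eq_succ_of_ne_zero (Nat.ceil_pos.2 (by positivity)).ne'
  rw [hk]
  set b := compressionBound P F fstar (k + 1) (1 / 20)
  have hk1 : 1 / r ≤ (k : ℝ) + 1 := by
    have := Nat.le_ceil (1 / r); rw [hk] at this; exact_mod_cast this
  have hk2 : (k : ℝ) * r ≤ 1 := by
    have : k < ⌈1 / r⌉₊ := by omega
    have := Nat.lt_ceil.1 this
    rw [lt_div_iff₀ hr] at this
    exact this.le
  set ν := Measure.pi fun _ : Fin k => P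
  set ρ := Measure.pi fun _ : Fin (k + 1) => P
  set T := disagreementPairs F fstar k
  have hT : NullMeasurableSet T (P.prod ν) := nullMeasurableSet_disagreementPairs hF hfs k
  set T' := toMeasurable (P.prod ν) T
  have hT' : MeasurableSet T' := measurableSet_toMeasurable _ _
  have hTT' : T' =ᵐ[P.prod ν] T := hT.toMeasurable_ae_eq
  -- `W` consists of the points that remain undetermined by `k` independent points with probability
  -- at least `3/4`. A classifier within `r / 4` of `fstar` agrees with it on such a sample with at
  -- least this probability, since `k * r ≤ 1`.
  set W : Set (X × Bool) := {z | 3 / 4 ≤ ν (Prod.mk z ⁻¹' T')}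
  have hW : MeasurableSet W :=
    measurableSet_le measurable_const (measurable_measure_prodMk_left hT')
  have hsplit := fun i : Fin (k + 1) =>
    measurePreserving_piFinSuccAbove (fun _ : Fin (k + 1) => P) i
  refine ⟨W, hW, ?_, ?_⟩
  swap
  · intro f hf hfr z hz
    refine (three_quarters_le_measure_agree (hF.measurable f hf) hfs hk2 hfr).trans
      (measure_mono fun S hS => subset_toMeasurable _ _ ?_)
    exact ⟨f, hf, hS, hz⟩
  set q := (k + 1 : ℝ) * P.real W
  have hq : 0 ≤ q := by positivity
  let D : Set ((X × Bool) × (Fin k → X × Bool)) := Prod.fst ⁻¹' W ∩ T'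
  have hD : MeasurableSet D := (measurable_fst hW).inter hT'
  have hDW : 3 / 4 * P.real W ≤ (P.prod ν).real D := by
    have h1 : ENNReal.ofReal (3 / 4) * P W ≤ (P.prod ν) D := by
      rw [Measure.prod_apply hD]
      calc ENNReal.ofReal (3 / 4) * P W = ∫⁻ _ in W, ENNReal.ofReal (3 / 4) ∂P := by simp
        _ ≤ ∫⁻ z in W, ν (Prod.mk z ⁻¹' D) ∂P := by
          refine setLIntegral_mono (measurable_measure_prodMk_left hD) fun z hz => ?_
          have e : Prod.mk z ⁻¹' D = Prod.mk z ⁻¹' T' := by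
            ext S; simp [D, hz]
          have h34 : (3 / 4 : ENNReal) = ENNReal.ofReal (3 / 4) := by
            rw [ENNReal.ofReal_div_of_pos (by norm_num)]; simp
          rw [e, ← h34]
          exact hz
        _ ≤ ∫⁻ z, ν (Prod.mk z ⁻¹' D) ∂P := setLIntegral_le_lintegral _ _
    have h2 := ENNReal.toReal_mono (measure_ne_top _ _) h1
    rwa [ENNReal.toReal_mul, ENNReal.toReal_ofReal (by norm_num)] at h2
  let E : Fin (k + 1) → Set (Fin (k + 1) → X × Bool) := fun i =>
    MeasurableEquiv.piFinSuccAbove (fun _ : Fin (k + 1) => X × Bool) i ⁻¹' D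
  have hE : ∀ i, MeasurableSet (E i) := fun i => (MeasurableEquiv.measurable _) hD
  have hEr : ∀ i, ρ.real (E i) = (P.prod ν).real D := fun i => by
    rw [measureReal_def, (hsplit i).measure_preimage hD.nullMeasurableSet, measureReal_def]
  -- `N` counts the sample points in `W` that the other `k` leave undetermined, so its mean is at
  -- least `3/4 * q`, where `q` is the expected number of points in `W`. The rest of the proof
  -- bounds this mean from above.
  let N : (Fin (k + 1) → X × Bool) → ℝ := fun S => ∑ i, (E i).indicator (fun _ => 1) S
  have hNint : ∀ i, Integrable ((E i).indicator fun _ => (1 : ℝ)) ρ := fun i =>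
    (integrable_const _).indicator (hE i)
  have hN : ∫ S, N S ∂ρ = (k + 1) * (P.prod ν).real D := by
    simp only [N]
    rw [integral_finsetSum _ fun i _ => hNint i]
    have : ∀ i, ∫ S, (E i).indicator (fun _ => (1 : ℝ)) S ∂ρ = (P.prod ν).real D := fun i => by
      rw [← hEr i, ← integral_indicator_one (hE i)]
      rfl
    simp [this]
  have hNle : ∀ᵐ S ∂ρ, N S ≤ compressionSize F S fstar := by
    have hae : ∀ i, ∀ᵐ S ∂ρ,
        MeasurableEquiv.piFinSuccAbove (fun _ : Fin (k + 1) => X × Bool) i S ∈ T' →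
        MeasurableEquiv.piFinSuccAbove (fun _ : Fin (k + 1) => X × Bool) i S ∈ T := fun i => by
      have h1 : ∀ᵐ w ∂(P.prod ν), w ∈ T' → w ∈ T := hTT'.mem_iff.mono fun w hw => hw.1
      exact (hsplit i).quasiMeasurePreserving.ae h1
    filter_upwards [ae_all_iff.2 hae] with S hS
    have e : N S = ((Finset.univ.filter fun i => S ∈ E i).card : ℝ) := by
      simp [N, Set.indicator_apply, Finset.sum_boole]
    rw [e]
    refine Nat.cast_le.2 (card_essential_le_compressionSize F S fstar _ fun i hi => ?_)
    exact hS i (Finset.mem_filter.1 hi).2.2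
  have hNK : ∀ S, N S ≤ count S W := by
    intro S
    refine Finset.sum_le_sum fun i _ => ?_
    by_cases hi : S ∈ E i
    · have : S i ∈ W := hi.1
      simp [hi, this]
    · rw [Set.indicator_of_notMem hi]
      exact Set.indicator_nonneg (fun _ _ => zero_le_one) _
  set G := {S : Fin (k + 1) → X × Bool | compressionSize F S fstar ≤ b}
  have hG : NullMeasurableSet G ρ := nullMeasurableSet_compressionSize_le hF hfs (k + 1) b
  have hGr : ρ.real Gᶜ ≤ 1 / 20 := by
    have h1 : 1 - 1 / 20 ≤ ρ.real G := compressionBound_spec F fstar (k + 1) (by norm_num)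
    have h2 : ρ.real Gᶜ = 1 - ρ.real G := by
      rw [measureReal_compl₀ hG, probReal_univ]
    linarith
  have hcount : ∫ S, count S W ∂ρ = q := by
    have := integral_count P (m := k + 1) hW
    rw [this]; push_cast; rfl
  have hmem : MemLp (fun S => count S W - q) 2 ρ :=
    (memLp_count P hW).sub (memLp_const q)
  have hvar : ∫ S, (count S W - q) ^ 2 ∂ρ ≤ q := by
    have h1 := variance_count_le P (m := k + 1) hW
    rw [ProbabilityTheory.variance_eq_integral (measurable_count hW).aemeasurable] at h1
    change ∫ S, (count S W - ∫ S, count S W ∂ρ) ^ 2 ∂ρ ≤ _ at h1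
    rw [hcount] at h1
    refine h1.trans (le_of_eq ?_)
    push_cast; rfl
  -- On `G` the count is at most `b`; off `G` it is at most `count S W`, and `x ≤ 1 + x ^ 2 / 4` for
  -- `x = count S W - q`. Integration gives `3/4 q ≤ b + 1 + q/20 + q/4`, hence `q ≤ 3 (b + 1)`.
  have hpt : ∀ᵐ S ∂ρ, N S ≤ (b + 1) + (Gᶜ.indicator (fun _ => q) S + (count S W - q) ^ 2 / 4) := by
    filter_upwards [hNle] with S hS
    have hsq : 0 ≤ (count S W - q) ^ 2 := sq_nonneg _
    by_cases hSG : S ∈ G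
    · have h1 : ((compressionSize F S fstar : ℕ) : ℝ) ≤ b := by exact_mod_cast hSG
      rw [Set.indicator_of_notMem (by simpa using hSG)]
      linarith
    · rw [Set.indicator_of_mem (by simpa using hSG)]
      have h1 := hNK S
      have h2 : (0 : ℝ) ≤ b := Nat.cast_nonneg b
      nlinarith [sq_nonneg (count S W - q - 2)]
  have hi1 : Integrable (Gᶜ.indicator fun _ => q) ρ :=
    (integrable_const q).indicator₀ hG.compl
  have hi2 : Integrable (fun S => (count S W - q) ^ 2 / 4) ρ := hmem.integrable_sq.div_const 4
  have hi12 : Integrable (fun S => Gᶜ.indicator (fun _ => q) S + (count S W - q) ^ 2 / 4) ρ :=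
    hi1.add hi2
  have hfin := integral_mono_ae (integrable_finsetSum _ fun i _ => hNint i)
    ((integrable_const ((b : ℝ) + 1)).add hi12) hpt
  change ∫ S, N S ∂ρ ≤ ∫ S, (((b : ℝ) + 1) + (Gᶜ.indicator (fun _ => q) S +
    (count S W - q) ^ 2 / 4)) ∂ρ at hfin
  rw [integral_add (integrable_const _) hi12, integral_add hi1 hi2,
    integral_indicator₀ hG.compl, integral_div, hN] at hfin
  simp only [integral_const, measureReal_restrict_apply_univ, smul_eq_mul, probReal_univ,
    one_mul] at hfin
  have h5 : ρ.real Gᶜ * q ≤ 1 / 20 * q := mul_le_mul_of_nonneg_right hGr hq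
  have h6 : (3 / 4 : ℝ) * q ≤ (k + 1) * (P.prod ν).real D := by
    have := mul_le_mul_of_nonneg_left hDW (by positivity : (0 : ℝ) ≤ k + 1)
    simp only [q]; linarith
  have h7 : q ≤ 3 * (b + 1) := by linarith
  have h8 : P.real W ≤ q * r := by
    rw [div_le_iff₀ hr] at hk1
    have := mul_le_mul_of_nonneg_right hk1 (measureReal_nonneg (μ := P) (s := W))
    simp only [q]; linarith
  exact h8.trans (mul_le_mul_of_nonneg_right h7 hr.le)

end Disagreement

/-! ### Pathwise properties of RobustCAL -/

section Deterministic

variable {X : Type*}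

/-- The state of RobustCAL after `j` rounds if the label budget is ignored. -/
noncomputable def unguardedState (F : Set (X → Bool)) (d : ℕ) (δ : ℝ) (point : ℕ → X)
    (label : ℕ → Bool) (j : ℕ) : RobustCALState X :=
  (robustCALStep d δ point label)^[j] ⟨0, [], F⟩

theorem deviationScale_nonneg (d : ℕ) {δ : ℝ} (hδ : 0 < δ) (hδ2 : δ < 1 / 2) (m : ℕ) :
    0 ≤ deviationScale d δ m := by
  rcases Nat.eq_zero_or_pos m with rfl | hm
  · simp [deviationScale]
  · exact (deviationScale_pos d hδ hδ2 hm).le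

theorem deviationBound_nonneg (d : ℕ) {δ : ℝ} (hδ : 0 < δ) (hδ2 : δ < 1 / 2) (m : ℕ)
    (Q : List (X × Bool)) (V : Set (X → Bool)) : 0 ≤ deviationBound d δ m Q V :=
  add_nonneg (Real.sqrt_nonneg _) (deviationScale_nonneg d hδ hδ2 m)

theorem robustCALStep_candidates_of_pow (d : ℕ) (δ : ℝ) (point : ℕ → X) (label : ℕ → Bool)
    (s : RobustCALState X) (hs : ∃ i : ℕ, s.seen + 1 = 2 ^ i) :
    (robustCALStep d δ point label s).candidates = {h ∈ s.candidates | ∀ g ∈ s.candidates,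
      (mistakes (robustCALStep d δ point label s).requested h : ℝ) -
        mistakes (robustCALStep d δ point label s).requested g ≤ (s.seen + 1 : ℕ) *
          deviationBound d δ (s.seen + 1) (robustCALStep d δ point label s).requested
            s.candidates} := by
  simp only [robustCALStep]
  rw [if_pos hs]

theorem robustCALStep_candidates_of_not_pow (d : ℕ) (δ : ℝ) (point : ℕ → X) (label : ℕ → Bool)
    (s : RobustCALState X) (hs : ¬ ∃ i : ℕ, s.seen + 1 = 2 ^ i) :
    (robustCALStep d δ point label s).candidates = s.candidates := by
  simp only [robustCALStep]
  rw [if_neg hs]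

theorem robustCALStep_requested_of_mem (d : ℕ) (δ : ℝ) (point : ℕ → X) (label : ℕ → Bool)
    (s : RobustCALState X) (hs : point s.seen ∈ disagreementRegion s.candidates) :
    (robustCALStep d δ point label s).requested =
      (point s.seen, label s.seen) :: s.requested := by
  simp only [robustCALStep]
  rw [if_pos hs]

theorem robustCALStep_requested_of_notMem (d : ℕ) (δ : ℝ) (point : ℕ → X) (label : ℕ → Bool)
    (s : RobustCALState X) (hs : point s.seen ∉ disagreementRegion s.candidates) :
    (robustCALStep d δ point label s).requested = s.requested := by
  simp only [robustCALStep]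
  rw [if_neg hs]

theorem robustCALStep_candidates_subset (d : ℕ) (δ : ℝ) (point : ℕ → X) (label : ℕ → Bool)
    (s : RobustCALState X) : (robustCALStep d δ point label s).candidates ⊆ s.candidates := by
  by_cases hs : ∃ i : ℕ, s.seen + 1 = 2 ^ i
  · rw [robustCALStep_candidates_of_pow d δ point label s hs]
    exact fun h hh => hh.1
  · rw [robustCALStep_candidates_of_not_pow d δ point label s hs]

theorem exists_mistakes_le (Q : List (X × Bool)) {V : Set (X → Bool)} (hV : V.Nonempty) :
    ∃ h ∈ V, ∀ g ∈ V, mistakes Q h ≤ mistakes Q g := by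
  obtain ⟨h, hh, hmin⟩ := Nat.sInf_mem (hV.image (mistakes Q))
  exact ⟨h, hh, fun g hg => hmin.le.trans (Nat.sInf_le ⟨g, hg, rfl⟩)⟩

theorem robustCALStep_candidates_nonempty (d : ℕ) {δ : ℝ} (hδ : 0 < δ) (hδ2 : δ < 1 / 2)
    (point : ℕ → X) (label : ℕ → Bool) (s : RobustCALState X) (hs : s.candidates.Nonempty) :
    (robustCALStep d δ point label s).candidates.Nonempty := by
  by_cases hp : ∃ i : ℕ, s.seen + 1 = 2 ^ i
  · rw [robustCALStep_candidates_of_pow d δ point label s hp]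
    obtain ⟨h, hh, hmin⟩ := exists_mistakes_le (robustCALStep d δ point label s).requested hs
    refine ⟨h, hh, fun g hg => ?_⟩
    have h1 := (Nat.cast_le (α := ℝ)).2 (hmin g hg)
    have h2 := mul_nonneg (Nat.cast_nonneg (s.seen + 1) : (0 : ℝ) ≤ _)
      (deviationBound_nonneg d hδ hδ2 (s.seen + 1) (robustCALStep d δ point label s).requested
        s.candidates)
    linarith
  · rwa [robustCALStep_candidates_of_not_pow d δ point label s hp]

theorem robustCALStep_requested_length_le (d : ℕ) (δ : ℝ) (point : ℕ → X) (label : ℕ → Bool)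
    (s : RobustCALState X) :
    (robustCALStep d δ point label s).requested.length ≤ s.requested.length + 1 := by
  simp only [robustCALStep]
  split_ifs <;> simp

theorem robustCAL_basic (F : Set (X → Bool)) (hF : F.Nonempty) (d : ℕ) {δ : ℝ} (hδ : 0 < δ)
    (hδ2 : δ < 1 / 2) (n u : ℕ) (point : ℕ → X) (label : ℕ → Bool) :
    (robustCAL F d δ n u point label).requested.length ≤ n ∧
      (robustCAL F d δ n u point label).candidates.Nonempty ∧
      (robustCAL F d δ n u point label).candidates ⊆ F := by
  unfold robustCAL
  refine Function.Iterate.rec (fun s : RobustCALState X => s.requested.length ≤ n ∧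
    s.candidates.Nonempty ∧ s.candidates ⊆ F) ?_ ?_ u
  · exact ⟨Nat.zero_le _, hF, subset_rfl⟩
  · rintro s ⟨h1, h2, h3⟩
    split_ifs with hs
    · exact ⟨(robustCALStep_requested_length_le d δ point label s).trans hs.1,
        robustCALStep_candidates_nonempty d hδ hδ2 point label s h2,
        (robustCALStep_candidates_subset d δ point label s).trans h3⟩
    · exact ⟨h1, h2, h3⟩

section Unguarded

variable (F : Set (X → Bool)) (d : ℕ) (δ : ℝ) (S : ℕ → X × Bool)

/-- The unguarded run of RobustCAL on a sequence of labeled points. -/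
noncomputable abbrev run (j : ℕ) : RobustCALState X :=
  unguardedState F d δ (fun i => (S i).1) (fun i => (S i).2) j

theorem run_succ (j : ℕ) : run F d δ S (j + 1) =
    robustCALStep d δ (fun i => (S i).1) (fun i => (S i).2) (run F d δ S j) :=
  Function.iterate_succ_apply' _ _ _

theorem run_seen (j : ℕ) : (run F d δ S j).seen = j := by
  induction j with
  | zero => rfl
  | succ j ih => rw [run_succ]; simp [robustCALStep, ih]

theorem run_candidates_antitone : Antitone fun j => (run F d δ S j).candidates :=
  antitone_nat_of_succ_le fun j => by
    rw [run_succ]; exact robustCALStep_candidates_subset _ _ _ _ _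

theorem run_candidates_subset (j : ℕ) : (run F d δ S j).candidates ⊆ F :=
  run_candidates_antitone F d δ S (Nat.zero_le j)

theorem run_requested_succ_of_mem {j : ℕ}
    (h : (S j).1 ∈ disagreementRegion (run F d δ S j).candidates) :
    (run F d δ S (j + 1)).requested = S j :: (run F d δ S j).requested := by
  rw [run_succ, robustCALStep_requested_of_mem _ _ _ _ _ (by rwa [run_seen]), run_seen]

theorem run_requested_succ_of_notMem {j : ℕ}
    (h : (S j).1 ∉ disagreementRegion (run F d δ S j).candidates) :
    (run F d δ S (j + 1)).requested = (run F d δ S j).requested := by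
  rw [run_succ, robustCALStep_requested_of_notMem _ _ _ _ _ (by rwa [run_seen])]

theorem run_candidates_succ_of_pow {j i : ℕ} (h : j + 1 = 2 ^ i) :
    (run F d δ S (j + 1)).candidates = {h ∈ (run F d δ S j).candidates |
      ∀ g ∈ (run F d δ S j).candidates, (mistakes (run F d δ S (j + 1)).requested h : ℝ) -
        mistakes (run F d δ S (j + 1)).requested g ≤ (j + 1 : ℕ) *
          deviationBound d δ (j + 1) (run F d δ S (j + 1)).requested
            (run F d δ S j).candidates} := by
  rw [run_succ, robustCALStep_candidates_of_pow _ _ _ _ _ ⟨i, by rwa [run_seen]⟩, run_seen]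

theorem run_candidates_succ_of_not_pow {j : ℕ} (h : ¬ ∃ i : ℕ, j + 1 = 2 ^ i) :
    (run F d δ S (j + 1)).candidates = (run F d δ S j).candidates := by
  rw [run_succ, robustCALStep_candidates_of_not_pow _ _ _ _ _ (by rwa [run_seen])]

/-- Sums over the requested points of quantities that vanish where `h` and `g` agree are sums over
all points. -/
theorem run_requested_sum (φ : X × Bool → ℝ) {h g : X → Bool}
    (hφ : ∀ z : X × Bool, h z.1 = g z.1 → φ z = 0) (j : ℕ)
    (hh : h ∈ (run F d δ S j).candidates) (hg : g ∈ (run F d δ S j).candidates) :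
    ((run F d δ S (j + 1)).requested.map φ).sum = ∑ i ∈ Finset.range (j + 1), φ (S i) := by
  have step : ∀ j, h ∈ (run F d δ S j).candidates → g ∈ (run F d δ S j).candidates →
      ((run F d δ S j).requested.map φ).sum = ∑ i ∈ Finset.range j, φ (S i) →
      ((run F d δ S (j + 1)).requested.map φ).sum = ∑ i ∈ Finset.range (j + 1), φ (S i) := by
    intro j hh hg ih
    rw [Finset.sum_range_succ]
    by_cases hm : (S j).1 ∈ disagreementRegion (run F d δ S j).candidates
    · rw [run_requested_succ_of_mem F d δ S hm, List.map_cons, List.sum_cons, ih, add_comm]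
    -- At an unrequested point the two candidates agree, so its term is zero. Candidates of a later
    -- round were candidates here too, so the induction may use the current set.
    · have : h (S j).1 = g (S j).1 := by
        by_contra hne
        exact hm ⟨h, hh, g, hg, hne⟩
      rw [run_requested_succ_of_notMem F d δ S hm, ih, hφ _ this, add_zero]
  have hanti := run_candidates_antitone F d δ S
  induction j with
  | zero => exact step 0 hh hg (by simp [unguardedState])
  | succ j ih =>
    exact step (j + 1) hh hg (ih (hanti j.le_succ hh) (hanti j.le_succ hg))

theorem run_requested_length_le (W : ℕ → Set (X × Bool)) (M : ℕ)
    (hW : ∀ j < M, (S j).1 ∈ disagreementRegion (run F d δ S j).candidates → S j ∈ W j) (j : ℕ)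
    (hj : j ≤ M) : ((run F d δ S j).requested.length : ℝ) ≤
      ∑ i ∈ Finset.range j, (W i).indicator (fun _ => (1 : ℝ)) (S i) := by
  induction j with
  | zero => simp [unguardedState]
  | succ j ih =>
    rw [Finset.sum_range_succ]
    have := ih (by omega)
    by_cases hm : (S j).1 ∈ disagreementRegion (run F d δ S j).candidates
    · rw [run_requested_succ_of_mem F d δ S hm, Set.indicator_of_mem (hW j (by omega) hm)]
      simpa using this
    · rw [run_requested_succ_of_notMem F d δ S hm]
      have h0 : 0 ≤ (W j).indicator (fun _ => (1 : ℝ)) (S j) :=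
        Set.indicator_nonneg (fun _ _ => zero_le_one) _
      linarith

/-- If the budgets are not exhausted in the first `M` rounds, then the final candidates are among
those of the unguarded run after `M` rounds. -/
theorem robustCAL_candidates_subset_run {n u M : ℕ} (hu : M ≤ u)
    (hn : ∀ j < M, (run F d δ S j).requested.length < n) :
    (robustCAL F d δ n u (fun i => (S i).1) (fun i => (S i).2)).candidates ⊆
      (run F d δ S M).candidates := by
  -- The guarded run is the unguarded run, frozen from some round on; under the assumptions it
  -- cannot freeze before round `M`.
  have key : ∀ k, k ≤ u → ∃ t, (fun s => if s.requested.length < n ∧ s.seen < u then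
      robustCALStep d δ (fun i => (S i).1) (fun i => (S i).2) s else s)^[k]
        (⟨0, [], F⟩ : RobustCALState X) = run F d δ S t ∧ min k M ≤ t ∧ t ≤ k := by
    intro k
    induction k with
    | zero => exact fun _ => ⟨0, rfl, by simp, le_rfl⟩
    | succ k ih =>
      intro hk
      obtain ⟨t, ht, h1, h2⟩ := ih (by omega)
      rw [Function.iterate_succ_apply', ht]
      by_cases hg : (run F d δ S t).requested.length < n ∧ (run F d δ S t).seen < u
      · exact ⟨t + 1, by rw [if_pos hg, run_succ], by omega, by omega⟩
      · refine ⟨t, by rw [if_neg hg], ?_, by omega⟩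
        by_contra hlt
        have htM : t < M := by omega
        exact hg ⟨hn t htM, by rw [run_seen]; omega⟩
  obtain ⟨t, ht, h1, -⟩ := key u le_rfl
  unfold robustCAL
  rw [ht]
  exact run_candidates_antitone F d δ S (by omega)

end Unguarded

theorem sum_map_sub_eq {α : Type*} (Q : List α) (f g : α → ℝ) :
    (Q.map fun z => f z - g z).sum = (Q.map f).sum - (Q.map g).sum := by
  induction Q with
  | nil => simp
  | cons z Q ih => simp only [List.map_cons, List.sum_cons, ih]; ring

theorem mistakes_eq_sum (Q : List (X × Bool)) (h : X → Bool) :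
    (mistakes Q h : ℝ) = (Q.map fun z => if h z.1 = z.2 then (0 : ℝ) else 1).sum := by
  induction Q with
  | nil => simp [mistakes]
  | cons z Q ih =>
    rw [List.map_cons, List.sum_cons, ← ih]
    unfold mistakes
    by_cases hz : h z.1 = z.2 <;> simp [hz, add_comm]

theorem countP_bne_eq_sum (Q : List (X × Bool)) (h g : X → Bool) :
    ((Q.countP fun z => h z.1 != g z.1 : ℕ) : ℝ) =
      (Q.map fun z => if h z.1 = g z.1 then (0 : ℝ) else 1).sum := by
  induction Q with
  | nil => simp
  | cons z Q ih =>
    rw [List.map_cons, List.sum_cons, ← ih]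
    by_cases hz : h z.1 = g z.1 <;> simp [hz, add_comm]

theorem indicator_errorDiff_sub (h g : X → Bool) (z : X × Bool) :
    (errorDiff h g).indicator (fun _ => (1 : ℝ)) z - (errorDiff g h).indicator (fun _ => (1 : ℝ)) z =
      (if h z.1 = z.2 then (0 : ℝ) else 1) - if g z.1 = z.2 then (0 : ℝ) else 1 := by
  by_cases h1 : h z.1 = z.2 <;> by_cases h2 : g z.1 = z.2 <;>
    simp [errorDiff, h1, h2]

theorem indicator_errorDiff_add (h g : X → Bool) (z : X × Bool) :
    (errorDiff h g).indicator (fun _ => (1 : ℝ)) z + (errorDiff g h).indicator (fun _ => (1 : ℝ)) z =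
      if h z.1 = g z.1 then (0 : ℝ) else 1 := by
  rcases z with ⟨x, y⟩
  cases h1 : h x <;> cases h2 : g x <;> cases y <;>
    simp [errorDiff, h1, h2]

theorem mistakes_sub_mistakes_eq (F : Set (X → Bool)) (d : ℕ) (δ : ℝ) (S : ℕ → X × Bool) {j : ℕ}
    {h g : X → Bool} (hh : h ∈ (run F d δ S j).candidates) (hg : g ∈ (run F d δ S j).candidates) :
    (mistakes (run F d δ S (j + 1)).requested h : ℝ) -
        mistakes (run F d δ S (j + 1)).requested g =
      count (fun i : Fin (j + 1) => S i) (errorDiff h g) -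
        count (fun i : Fin (j + 1) => S i) (errorDiff g h) := by
  have h1 := run_requested_sum F d δ S
    (fun z => (if h z.1 = z.2 then (0 : ℝ) else 1) - if g z.1 = z.2 then (0 : ℝ) else 1)
    (h := h) (g := g) (fun z hz => by simp [hz]) j hh hg
  rw [mistakes_eq_sum, mistakes_eq_sum, ← sum_map_sub_eq, h1, count, count,
    ← Finset.sum_sub_distrib, Finset.sum_range]
  exact Finset.sum_congr rfl fun i _ => (indicator_errorDiff_sub h g _).symm

theorem countP_bne_eq (F : Set (X → Bool)) (d : ℕ) (δ : ℝ) (S : ℕ → X × Bool) {j : ℕ}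
    {h g : X → Bool} (hh : h ∈ (run F d δ S j).candidates) (hg : g ∈ (run F d δ S j).candidates) :
    (((run F d δ S (j + 1)).requested.countP fun z => h z.1 != g z.1 : ℕ) : ℝ) =
      count (fun i : Fin (j + 1) => S i) (errorDiff h g) +
        count (fun i : Fin (j + 1) => S i) (errorDiff g h) := by
  have h1 := run_requested_sum F d δ S (fun z => if h z.1 = g z.1 then (0 : ℝ) else 1)
    (h := h) (g := g) (fun z hz => by simp [hz]) j hh hg
  rw [countP_bne_eq_sum, h1, count, count, ← Finset.sum_add_distrib, Finset.sum_range]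
  exact Finset.sum_congr rfl fun i _ => (indicator_errorDiff_add h g _).symm

theorem empiricalDiameter_bddAbove (Q : List (X × Bool)) (V : Set (X → Bool)) :
    BddAbove {k | ∃ h ∈ V, ∃ g ∈ V, k = Q.countP fun z => h z.1 != g z.1} := by
  refine ⟨Q.length, ?_⟩
  rintro _ ⟨h, _, g, _, rfl⟩
  exact List.countP_le_length

theorem le_empiricalDiameter {Q : List (X × Bool)} {V : Set (X → Bool)} {h g : X → Bool}
    (hh : h ∈ V) (hg : g ∈ V) : (Q.countP fun z => h z.1 != g z.1) ≤ empiricalDiameter Q V :=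
  le_csSup (empiricalDiameter_bddAbove Q V) ⟨h, hh, g, hg, rfl⟩

theorem exists_empiricalDiameter_eq (Q : List (X × Bool)) {V : Set (X → Bool)} (hV : V.Nonempty) :
    ∃ h ∈ V, ∃ g ∈ V, empiricalDiameter Q V = Q.countP fun z => h z.1 != g z.1 :=
  Nat.sSup_mem (s := {k | ∃ h ∈ V, ∃ g ∈ V, k = Q.countP fun z => h z.1 != g z.1})
    ⟨_, hV.choose, hV.choose_spec, hV.choose, hV.choose_spec, rfl⟩ (empiricalDiameter_bddAbove Q V)

end Deterministic

/-! ### Empirical deviation bounds and the effect of one stage -/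

section Stages

/-- The algorithm sees only the frequency `x`. Solving the quadratic inequality for `√p` gives `√p ≤
3/2 √x + 7 u`, which lets `√x` replace `√p`. -/
theorem abs_sub_le_of_relative {x p e : ℝ} (hx : 0 ≤ x) (hp : 0 ≤ p) (he : 0 ≤ e)
    (h : |x - p| ≤ 4 * √(e / 100) * √p + 16 * (e / 100)) :
    |x - p| ≤ 6 * √(e / 100) * √x + 44 * (e / 100) ∧ x ≤ 2 * p + 20 * (e / 100) := by
  set u := √(e / 100)
  have hu0 : 0 ≤ u := Real.sqrt_nonneg _
  have hu : u ^ 2 = e / 100 := Real.sq_sqrt (by positivity)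
  rw [← hu] at h ⊢
  set s := √p
  have hs0 : 0 ≤ s := Real.sqrt_nonneg _
  have hs : s ^ 2 = p := Real.sq_sqrt hp
  set t := √x
  have ht0 : 0 ≤ t := Real.sqrt_nonneg _
  have ht : t ^ 2 = x := Real.sq_sqrt hx
  have h1 := abs_le.1 h
  have hst : s ≤ 3 / 2 * t + 7 * u := by
    refine le_of_sq_le_sq ?_ (by positivity)
    have : s ^ 2 ≤ 2 * t ^ 2 + 48 * u ^ 2 := by nlinarith [sq_nonneg (s - 4 * u)]
    nlinarith [mul_nonneg ht0 hu0]
  refine ⟨h.trans ?_, ?_⟩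
  · nlinarith
  · nlinarith [sq_nonneg (s - 2 * u)]

end Stages

section StageBounds

variable {X : Type*} [MeasurableSpace X] {P : Measure (X × Bool)} [IsProbabilityMeasure P]

theorem errorRate_sub_errorRate {f g : X → Bool} (hf : Measurable f) (hg : Measurable g) :
    errorRate P f - errorRate P g = P.real (errorDiff f g) - P.real (errorDiff g f) := by
  have hms : ∀ {h : X → Bool}, Measurable h → MeasurableSet {z : X × Bool | h z.1 = z.2} :=
    fun hh => measurableSet_eq_fun (hh.comp measurable_fst) measurable_snd
  have h1 := measureReal_inter_add_sdiff (μ := P) (s := {z : X × Bool | f z.1 ≠ z.2}) (hms hg)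
  have h2 := measureReal_inter_add_sdiff (μ := P) (s := {z : X × Bool | g z.1 ≠ z.2}) (hms hf)
  have e : {z : X × Bool | f z.1 ≠ z.2} \ {z : X × Bool | g z.1 = z.2} =
      {z : X × Bool | g z.1 ≠ z.2} \ {z : X × Bool | f z.1 = z.2} := by
    ext z
    exact and_comm
  rw [e] at h1
  change _ = errorRate P f at h1
  change _ = errorRate P g at h2
  change P.real (errorDiff f g) + _ = _ at h1
  change P.real (errorDiff g f) + _ = _ at h2
  linarith

theorem disagreeProb_eq {f g : X → Bool} (hf : Measurable f) (hg : Measurable g) :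
    disagreeProb P f g = P.real (errorDiff f g) + P.real (errorDiff g f) := by
  rw [← measureReal_union (Set.disjoint_left.2 fun z h1 h2 => h1.1 h2.2)
    (measurableSet_errorDiff hg hf)]
  unfold disagreeProb
  congr 1
  ext ⟨x, y⟩
  cases h1 : f x <;> cases h2 : g x <;> cases y <;> simp [errorDiff, h1, h2]

theorem disagreeProb_le_add (f g h : X → Bool) :
    disagreeProb P f g ≤ disagreeProb P f h + disagreeProb P g h := by
  refine (measureReal_mono ?_).trans (measureReal_union_le _ _)
  intro z hz
  by_contra hn
  simp only [Set.mem_union, Set.mem_ofPred_eq, not_or, not_not] at hn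
  exact hz (hn.1.trans hn.2.symm)

theorem count_nonneg {Z : Type*} {m : ℕ} (S : Fin m → Z) (A : Set Z) : 0 ≤ count S A :=
  Finset.sum_nonneg fun _ _ => Set.indicator_nonneg (fun _ _ => zero_le_one) _

/-- The first bound has the shape of `deviationBound`, but with `88 / 100 * e` as last term; the
remaining `12 / 100 * e` is slack for a comparison classifier that is only nearly optimal. -/
theorem Concentrated.bounds {F : Set (X → Bool)} {e : ℝ} (he : 0 ≤ e) {m : ℕ}
    {S : Fin m → X × Bool} (hS : Concentrated P F e S) {f g : X → Bool} (hfF : f ∈ F)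
    (hgF : g ∈ F) (hf : Measurable f) (hg : Measurable g) :
    |(count S (errorDiff f g) - count S (errorDiff g f)) / m -
        (errorRate P f - errorRate P g)| ≤
      √((count S (errorDiff f g) + count S (errorDiff g f)) / m * e) + 88 / 100 * e ∧
    (count S (errorDiff f g) + count S (errorDiff g f)) / m ≤
      2 * disagreeProb P f g + 4 / 10 * e := by
  have hx : 0 ≤ count S (errorDiff f g) / m := div_nonneg (count_nonneg _ _) (Nat.cast_nonneg _)
  have hy : 0 ≤ count S (errorDiff g f) / m := div_nonneg (count_nonneg _ _) (Nat.cast_nonneg _)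
  have h1 := abs_sub_le_of_relative hx measureReal_nonneg he (hS f hfF g hgF)
  have h2 := abs_sub_le_of_relative hy measureReal_nonneg he (hS g hgF f hfF)
  rw [errorRate_sub_errorRate hf hg, disagreeProb_eq hf hg, sub_div, add_div]
  set x := count S (errorDiff f g) / m
  set y := count S (errorDiff g f) / m
  set p := P.real (errorDiff f g)
  set q := P.real (errorDiff g f)
  refine ⟨?_, by linarith [h1.2, h2.2]⟩
  have h3 : |x - y - (p - q)| ≤ |x - p| + |y - q| := by
    rw [show x - y - (p - q) = (x - p) - (y - q) by ring]
    exact abs_sub _ _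
  have h4 : 6 * √(e / 100) * √x + 6 * √(e / 100) * √y ≤ √((x + y) * e) := by
    refine Real.le_sqrt_of_sq_le ?_
    have hu : √(e / 100) ^ 2 = e / 100 := Real.sq_sqrt (by positivity)
    have hs : √x ^ 2 = x := Real.sq_sqrt hx
    have ht : √y ^ 2 = y := Real.sq_sqrt hy
    have h5 : (√x + √y) ^ 2 ≤ 2 * (x + y) := by nlinarith [sq_nonneg (√x - √y)]
    calc (6 * √(e / 100) * √x + 6 * √(e / 100) * √y) ^ 2
        = 36 * √(e / 100) ^ 2 * (√x + √y) ^ 2 := by ring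
      _ ≤ 36 * (e / 100) * (2 * (x + y)) := by rw [hu]; gcongr
      _ ≤ (x + y) * e := by nlinarith [mul_nonneg (add_nonneg hx hy) he]
  linarith [h1.1, h2.1]

variable {F : Set (X → Bool)} {d : ℕ} {δ : ℝ} {S : ℕ → X × Bool}

/-- Since `fstar` may lie outside `F`, a nearly optimal `g ∈ F` replaces it. Its empirical excess
over any candidate is at most `τ` plus the deviation, and `τ` fits into the slack of the threshold.
-/
theorem mem_run_candidates_of_concentrated (hF : ∀ f ∈ F, Measurable f) (hδ : 0 < δ)
    (hδ2 : δ < 1 / 2) {I : ℕ}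
    (hS : ∀ i ≤ I, Concentrated P F (deviationScale d δ (2 ^ i)) fun t : Fin (2 ^ i) => S t)
    {g : X → Bool} (hg : g ∈ F) {τ : ℝ} (hτ : ∀ h ∈ F, errorRate P g ≤ errorRate P h + τ)
    (hτe : ∀ i ≤ I, τ ≤ 12 / 100 * deviationScale d δ (2 ^ i)) (j : ℕ) (hj : j ≤ 2 ^ I) :
    g ∈ (run F d δ S j).candidates := by
  induction j with
  | zero => exact hg
  | succ j ih =>
    have hgj := ih (by omega)
    by_cases hp : ∃ i : ℕ, j + 1 = 2 ^ i
    · obtain ⟨i, hi⟩ := hp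
      have hiI : i ≤ I := (Nat.pow_le_pow_iff_right (by norm_num)).1 (hi ▸ hj)
      rw [run_candidates_succ_of_pow F d δ S hi]
      refine ⟨hgj, fun h hh => ?_⟩
      have hhF := run_candidates_subset F d δ S j hh
      have hc := hS i hiI
      have hτi := hτe i hiI
      rw [← hi] at hc hτi
      have he := deviationScale_nonneg d hδ hδ2 (j + 1)
      have hb := (hc.bounds he hg hhF (hF g hg) (hF h hhF)).1
      rw [mistakes_sub_mistakes_eq F d δ S hgj hh]
      rw [← countP_bne_eq F d δ S hgj hh] at hb
      have hm : (0 : ℝ) < (j + 1 : ℕ) := by positivity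
      have hdiam : √(((run F d δ S (j + 1)).requested.countP fun z => g z.1 != h z.1 : ℕ) /
          ((j + 1 : ℕ) : ℝ) * deviationScale d δ (j + 1)) ≤
          √(empiricalDiameter (run F d δ S (j + 1)).requested (run F d δ S j).candidates /
            ((j + 1 : ℕ) : ℝ) * deviationScale d δ (j + 1)) := by
        refine Real.sqrt_le_sqrt (mul_le_mul_of_nonneg_right ?_ he)
        exact div_le_div_of_nonneg_right (Nat.cast_le.2 (le_empiricalDiameter hgj hh)) hm.le
      have h1 := (abs_le.1 hb).2
      have h2 := hτ h hhF
      rw [← div_le_iff₀' hm]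
      unfold deviationBound
      linarith
    · rw [run_candidates_succ_of_not_pow F d δ S hp]
      exact hgj

/-- The factor `2` adds the elimination threshold and the deviation of the sample. Two candidates
are at distance at most `2 * D`, and an empirical distance is at most twice the true one plus `4 /
10 * e`, whence `4 * D`. -/
theorem excess_le_of_mem_run_candidates (hF : ∀ f ∈ F, Measurable f) (hδ : 0 < δ)
    (hδ2 : δ < 1 / 2) {i j : ℕ} (hi : j + 1 = 2 ^ i)
    (hS : Concentrated P F (deviationScale d δ (2 ^ i)) fun t : Fin (2 ^ i) => S t)
    {fstar g : X → Bool} (hg : g ∈ (run F d δ S j).candidates) {D : ℝ}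
    (hD : ∀ h ∈ (run F d δ S j).candidates, disagreeProb P h fstar ≤ D) {h : X → Bool}
    (hh : h ∈ (run F d δ S (2 ^ i)).candidates) :
    errorRate P h - errorRate P g ≤ 2 * (√((4 * D + 4 / 10 * deviationScale d δ (2 ^ i)) *
      deviationScale d δ (2 ^ i)) + deviationScale d δ (2 ^ i)) := by
  rw [← hi] at hS hh ⊢
  rw [run_candidates_succ_of_pow F d δ S hi] at hh
  obtain ⟨hhj, hmis⟩ := hh
  have hmis := hmis g hg
  have hsub := run_candidates_subset F d δ S j
  have he := deviationScale_nonneg d hδ hδ2 (j + 1)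
  have hm : (0 : ℝ) < (j + 1 : ℕ) := by positivity
  have hb := (hS.bounds he (hsub hhj) (hsub hg) (hF h (hsub hhj)) (hF g (hsub hg))).1
  rw [mistakes_sub_mistakes_eq F d δ S hhj hg, ← div_le_iff₀' hm] at hmis
  rw [← countP_bne_eq F d δ S hhj hg] at hb
  set e := deviationScale d δ (j + 1)
  set Q := (run F d δ S (j + 1)).requested
  set V := (run F d δ S j).candidates
  have hdiam : √((Q.countP fun z => h z.1 != g z.1 : ℕ) / ((j + 1 : ℕ) : ℝ) * e) ≤
      √(empiricalDiameter Q V / ((j + 1 : ℕ) : ℝ) * e) := by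
    refine Real.sqrt_le_sqrt (mul_le_mul_of_nonneg_right ?_ he)
    exact div_le_div_of_nonneg_right (Nat.cast_le.2 (le_empiricalDiameter hhj hg)) hm.le
  obtain ⟨h1, hh1, h2, hh2, hmax⟩ := exists_empiricalDiameter_eq Q (V := V) ⟨g, hg⟩
  have hb2 := (hS.bounds he (hsub hh1) (hsub hh2) (hF h1 (hsub hh1)) (hF h2 (hsub hh2))).2
  rw [← countP_bne_eq F d δ S hh1 hh2, ← hmax] at hb2
  have hD2 : disagreeProb P h1 h2 ≤ 2 * D := by
    have := disagreeProb_le_add (P := P) h1 h2 fstar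
    linarith [hD h1 hh1, hD h2 hh2]
  have hU : √(empiricalDiameter Q V / ((j + 1 : ℕ) : ℝ) * e) ≤ √((4 * D + 4 / 10 * e) * e) :=
    Real.sqrt_le_sqrt (mul_le_mul_of_nonneg_right (by linarith) he)
  have hlow := (abs_le.1 hb).1
  unfold deviationBound at hmis
  linarith

end StageBounds

/-! ### Finite samples of the i.i.d. sequence and Chernoff's bound -/

section Chernoff

variable {Z : Type*} [MeasurableSpace Z] {μ : Measure Z} [IsProbabilityMeasure μ]

theorem measurePreserving_restrict_fin (M : ℕ) :
    MeasurePreserving (fun (S : ℕ → Z) (t : Fin M) => S t)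
      (Measure.infinitePi fun _ : ℕ => μ) (Measure.pi fun _ : Fin M => μ) := by
  have hm : Measurable fun (S : ℕ → Z) (t : Fin M) => S t :=
    measurable_pi_lambda _ fun t => measurable_pi_apply _
  refine ⟨hm, (Measure.pi_eq fun s hs => ?_).symm⟩
  rw [Measure.map_apply hm (MeasurableSet.univ_pi hs)]
  have hset : (fun (S : ℕ → Z) (t : Fin M) => S t) ⁻¹' Set.univ.pi s =
      Set.pi (Finset.range M : Set ℕ) fun i => if h : i < M then s ⟨i, h⟩ else Set.univ := by
    ext S
    simp only [Set.mem_preimage, Set.mem_pi, Set.mem_univ, true_implies, Finset.coe_range,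
      Set.mem_Iio]
    constructor
    · intro h i hi
      rw [dif_pos hi]
      exact h ⟨i, hi⟩
    · intro h i
      have := h i i.2
      rwa [dif_pos i.2] at this
  rw [hset, Measure.infinitePi_pi]
  · rw [Finset.prod_range]
    exact Finset.prod_congr rfl fun i _ => by rw [dif_pos i.2]
  · intro i hi
    rw [dif_pos (Finset.mem_range.1 hi)]
    exact hs _

/-- The integral is `1 + (exp 1 - 1) * μ.real W`, and `exp 1 - 1 ≤ 2`. -/
theorem integral_exp_indicator_le {W : Set Z} (hW : MeasurableSet W) :
    ∫ z, Real.exp (W.indicator (fun _ => (1 : ℝ)) z) ∂μ ≤ Real.exp (2 * μ.real W) := by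
  have e : ∀ z, Real.exp (W.indicator (fun _ => (1 : ℝ)) z) =
      1 + W.indicator (fun _ => Real.exp 1 - 1) z := by
    intro z
    by_cases hz : z ∈ W <;> simp [hz]
  simp_rw [e]
  rw [integral_add (integrable_const _) ((integrable_const _).indicator hW),
    integral_indicator_const _ hW]
  simp only [integral_const, probReal_univ, smul_eq_mul, one_mul]
  have h1 := Real.add_one_le_exp (2 * μ.real W)
  have h2 : μ.real W * (Real.exp 1 - 1) ≤ μ.real W * 2 :=
    mul_le_mul_of_nonneg_left (by linarith [Real.exp_one_lt_d9]) measureReal_nonneg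
  linarith

/-- Chernoff's bound for the number of independent points in a sequence of sets. -/
theorem measure_sum_indicator_ge_le {W : ℕ → Set Z} (hW : ∀ i, MeasurableSet (W i)) (M : ℕ)
    (t : ℝ) :
    Measure.infinitePi (fun _ : ℕ => μ) {S | 2 * ∑ i ∈ Finset.range M, μ.real (W i) + t ≤
      ∑ i ∈ Finset.range M, (W i).indicator (fun _ => (1 : ℝ)) (S i)} ≤
      ENNReal.ofReal (Real.exp (-t)) := by
  set p := ∑ i ∈ Finset.range M, μ.real (W i)
  let Y : (Fin M → Z) → ℝ := fun S => ∑ i : Fin M, (W i).indicator (fun _ => (1 : ℝ)) (S i)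
  have hY : Measurable Y := Finset.measurable_sum _ fun i _ =>
    (measurable_const.indicator (hW i)).comp (measurable_pi_apply i)
  have hset : {S : ℕ → Z | 2 * p + t ≤
      ∑ i ∈ Finset.range M, (W i).indicator (fun _ => (1 : ℝ)) (S i)} =
      (fun (S : ℕ → Z) (t : Fin M) => S t) ⁻¹' {S | 2 * p + t ≤ Y S} := by
    ext S
    simp only [Set.mem_ofPred_eq, Set.mem_preimage, Y, Finset.sum_range]
  rw [hset, (measurePreserving_restrict_fin M).measure_preimage
    (measurableSet_le measurable_const hY).nullMeasurableSet, ← ofReal_measureReal]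
  refine ENNReal.ofReal_le_ofReal ?_
  have hYle : ∀ S, Y S ≤ M := by
    intro S
    calc Y S ≤ ∑ _i : Fin M, (1 : ℝ) := Finset.sum_le_sum fun i _ =>
          Set.indicator_le_self' (fun _ _ => zero_le_one) _
      _ = M := by simp
  have hint : Integrable (fun S => Real.exp (1 * Y S)) (Measure.pi fun _ : Fin M => μ) := by
    refine Integrable.of_bound (C := Real.exp M)
      (Real.measurable_exp.comp (hY.const_mul 1)).aestronglyMeasurable (.of_forall fun S => ?_)
    rw [Real.norm_eq_abs, abs_of_pos (Real.exp_pos _), one_mul]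
    exact Real.exp_le_exp.2 (hYle S)
  refine (ProbabilityTheory.measure_ge_le_exp_mul_mgf (2 * p + t) zero_le_one hint).trans ?_
  have hmgf : ProbabilityTheory.mgf Y (Measure.pi fun _ : Fin M => μ) 1 ≤ Real.exp (2 * p) := by
    unfold ProbabilityTheory.mgf
    simp only [one_mul, Y, Real.exp_sum]
    rw [integral_fintype_prod_eq_prod (fun (i : Fin M) z =>
      Real.exp ((W i).indicator (fun _ => (1 : ℝ)) z))]
    calc _ ≤ ∏ i : Fin M, Real.exp (2 * μ.real (W i)) :=
          Finset.prod_le_prod (fun i _ => integral_nonneg fun _ => (Real.exp_pos _).le)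
            fun i _ => integral_exp_indicator_le (hW i)
      _ = Real.exp (2 * p) := by
          rw [← Real.exp_sum, ← Finset.mul_sum]
          simp only [p, Finset.sum_range]
  calc Real.exp (-1 * (2 * p + t)) * ProbabilityTheory.mgf Y (Measure.pi fun _ : Fin M => μ) 1
      ≤ Real.exp (-1 * (2 * p + t)) * Real.exp (2 * p) :=
        mul_le_mul_of_nonneg_left hmgf (Real.exp_pos _).le
    _ = Real.exp (-t) := by rw [← Real.exp_add]; ring_nf

end Chernoff

/-! ### Sums over stages and the size of the deviation scale -/

section Arithmetic

theorem sum_range_one_div_sq_le (n : ℕ) :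
    ∑ i ∈ Finset.range (n + 1), 1 / ((i : ℝ) + 1) ^ 2 ≤ 2 - 1 / ((n : ℝ) + 1) := by
  induction n with
  | zero => norm_num
  | succ n ih =>
    rw [Finset.sum_range_succ]
    push_cast
    have h : 1 / ((n : ℝ) + 1 + 1) ^ 2 ≤ 1 / (n + 1) - 1 / (n + 1 + 1) := by
      rw [div_sub_div _ _ (by positivity) (by positivity), div_le_div_iff₀ (by positivity)
        (by positivity)]
      nlinarith [(Nat.cast_nonneg n : (0 : ℝ) ≤ n)]
    linarith

theorem sum_confidence_le {δ : ℝ} (hδ : 0 < δ) (I : ℕ) :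
    ∑ i ∈ Finset.range (I + 1), confidence δ (2 ^ i) ≤ 2 * δ := by
  have h : ∀ i : ℕ, confidence δ (2 ^ i) = δ * (1 / ((i : ℝ) + 1) ^ 2) := by
    intro i
    unfold confidence
    have : Real.logb 2 (2 * ((2 ^ i : ℕ) : ℝ)) = i + 1 := by
      push_cast
      rw [← pow_succ', Real.logb_pow, Real.logb_self_eq_one (by norm_num)]
      push_cast
      ring
    rw [this]
    ring
  simp_rw [h]
  rw [← Finset.mul_sum]
  have h1 := sum_range_one_div_sq_le I
  have h2 : (0 : ℝ) ≤ 1 / (I + 1) := by positivity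
  nlinarith

/-- All points of the stages before `I - k` are charged in full, and each of the at most `k`
remaining stages costs at most `Y`. Thus the number of stages enters only through `k`. -/
theorem sum_two_pow_mul_le {p : ℕ → ℝ} {I k : ℕ} {Y : ℝ} (hp : ∀ i, p i ≤ 1)
    (hY : ∀ i < I, 2 ^ i * p i ≤ Y) (hY0 : 0 ≤ Y) :
    ∑ i ∈ Finset.range I, 2 ^ i * p i ≤ 2 ^ (I - k) + k * Y := by
  have hI : I = (I - k) + (I - (I - k)) := by omega
  conv_lhs => rw [hI]
  rw [Finset.sum_range_add]
  refine add_le_add ?_ ?_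
  · calc ∑ i ∈ Finset.range (I - k), 2 ^ i * p i ≤ ∑ i ∈ Finset.range (I - k), (2 : ℝ) ^ i :=
          Finset.sum_le_sum fun i _ => mul_le_of_le_one_right (by positivity) (hp i)
      _ ≤ 2 ^ (I - k) := by
          rw [geom_sum_eq (by norm_num)]
          norm_num
  · calc ∑ i ∈ Finset.range (I - (I - k)), 2 ^ (I - k + i) * p (I - k + i)
        ≤ ∑ _i ∈ Finset.range (I - (I - k)), Y :=
          Finset.sum_le_sum fun i hi => hY _ (by have := Finset.mem_range.1 hi; omega)
      _ ≤ k * Y := by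
          rw [Finset.sum_const, Finset.card_range, nsmul_eq_mul]
          exact mul_le_mul_of_nonneg_right (Nat.cast_le.2 (by omega)) hY0

/-- The point with index `j` in `[2 ^ i, 2 ^ (i + 1))` is met by the candidates left after `2 ^ i`
rounds; index `0` precedes every stage. -/
theorem sum_range_two_pow_log (p : ℕ → ℝ) (p₀ : ℝ) (I : ℕ) :
    ∑ j ∈ Finset.range (2 ^ I), (if j = 0 then p₀ else p (Nat.log 2 j)) =
      p₀ + ∑ i ∈ Finset.range I, 2 ^ i * p i := by
  induction I with
  | zero => simp
  | succ I ih =>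
    rw [pow_succ, mul_two, Finset.sum_range_add, ih, Finset.sum_range_succ, add_assoc]
    congr 2
    have : ∀ x ∈ Finset.range (2 ^ I),
        (if 2 ^ I + x = 0 then p₀ else p (Nat.log 2 (2 ^ I + x))) = p I := by
      intro x hx
      have hx := Finset.mem_range.1 hx
      have hpos : 0 < 2 ^ I := by positivity
      rw [if_neg (by omega)]
      congr 1
      exact (Nat.log_eq_iff (Or.inr ⟨by norm_num, by omega⟩)).2 ⟨by omega, by rw [pow_succ]; omega⟩
    rw [Finset.sum_congr rfl this]
    simp

/-- For sample sizes of order `L / ε ^ 2` the logarithms of `m` cost only a constant: `log L ≤ L`,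
`d * log (L / d) ≤ L` and the linear bound on `log (logb 2 (2 * m))` absorb them into `L`. -/
theorem mul_deviationScale_le {d : ℕ} (hd : 1 ≤ d) {ε δ : ℝ} (hε : 0 < ε) (hε2 : ε < 1 / 2)
    (hδ : 0 < δ) (hδ2 : δ < 1 / 2) {m : ℕ} (hm : 1 ≤ m)
    (hmle : (m : ℝ) ≤ 2 ^ 25 * (d * Real.log (1 / ε) + Real.log (1 / δ)) * (1 / ε) ^ 2) :
    m * deviationScale d δ m ≤ 2 ^ 17 * (d * Real.log (1 / ε) + Real.log (1 / δ)) := by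
  have hlog1 := Real.log_two_gt_d9
  have hlog2 := Real.log_two_lt_d9
  have hd' : (1 : ℝ) ≤ d := by exact_mod_cast hd
  have hm' : (1 : ℝ) ≤ m := by exact_mod_cast hm
  have hE : 2 ≤ 1 / ε := by rw [le_div_iff₀ hε]; linarith
  have hD : 2 ≤ 1 / δ := by rw [le_div_iff₀ hδ]; linarith
  set ℓ := Real.log (1 / ε)
  have hℓ : Real.log 2 ≤ ℓ := Real.log_le_log (by norm_num) hE
  have hδl : Real.log 2 ≤ Real.log (1 / δ) := Real.log_le_log (by norm_num) hD
  set L := (d : ℝ) * ℓ + Real.log (1 / δ)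
  have hL1 : ℓ ≤ L := by
    have : ℓ ≤ d * ℓ := le_mul_of_one_le_left (by linarith) hd'
    simp only [L]; linarith
  have hLd : (d : ℝ) * 0.69 ≤ L := by
    have : (d : ℝ) * 0.69 ≤ d * ℓ := mul_le_mul_of_nonneg_left (by linarith) (by linarith)
    simp only [L]; linarith
  have hL2 : 1 ≤ L := by
    have : ℓ ≤ d * ℓ := le_mul_of_one_le_left (by linarith) hd'
    simp only [L]; linarith
  have hlogm : Real.log m ≤ 25 * Real.log 2 + Real.log L + 2 * ℓ := by
    have h := Real.log_le_log (by linarith) hmle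
    rw [Real.log_mul (by positivity) (by positivity), Real.log_mul (by norm_num) (by positivity),
      Real.log_pow, Real.log_pow] at h
    exact_mod_cast h
  have hlogL : Real.log L ≤ L := (Real.log_le_sub_one_of_pos (by linarith)).trans (by linarith)
  rw [mul_deviationScale d δ hm]
  have hcap : (d : ℝ) * Real.log (Real.exp 1 * max (m : ℝ) d / d) ≤
      d * (25 * Real.log 2 + 2 * ℓ) + L := by
    have hLd' : 0 < L / d := by positivity
    have h1 : max (m : ℝ) d / d ≤ 2 ^ 25 * (L / d) * (1 / ε) ^ 2 := by
      rw [div_le_iff₀ (by linarith)]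
      have e : 2 ^ 25 * (L / d) * (1 / ε) ^ 2 * d = 2 ^ 25 * L * (1 / ε) ^ 2 := by
        field_simp
      rw [e]
      refine max_le hmle ?_
      have : (4 : ℝ) ≤ (1 / ε) ^ 2 := by nlinarith
      nlinarith
    have h2 : Real.log (Real.exp 1 * max (m : ℝ) d / d) ≤
        1 + (25 * Real.log 2 + (L / d - 1) + 2 * ℓ) := by
      rw [mul_div_assoc, Real.log_mul (Real.exp_pos 1).ne'
        (div_pos (lt_max_of_lt_left (by linarith)) (by linarith)).ne', Real.log_exp]
      have h := Real.log_le_log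
        (div_pos (lt_max_of_lt_left (by linarith : (0 : ℝ) < m)) (by linarith)) h1
      rw [Real.log_mul (by positivity) (by positivity), Real.log_mul (by norm_num) hLd'.ne',
        Real.log_pow, Real.log_pow] at h
      have h3 := Real.log_le_sub_one_of_pos hLd'
      push_cast at h
      linarith
    calc (d : ℝ) * Real.log (Real.exp 1 * max (m : ℝ) d / d)
        ≤ d * (1 + (25 * Real.log 2 + (L / d - 1) + 2 * ℓ)) :=
          mul_le_mul_of_nonneg_left h2 (by linarith)
      _ = d * (25 * Real.log 2 + 2 * ℓ) + L := by field_simp; ring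
  have hconf : Real.log (1 / confidence δ m) ≤ Real.log (1 / δ) + 2 * (Real.log m / Real.log 2) := by
    have hb := one_le_logb_two_mul hm
    have e : 1 / confidence δ m = 1 / δ * Real.logb 2 (2 * m) ^ 2 := by
      unfold confidence; field_simp
    rw [e, Real.log_mul (by positivity) (by positivity), Real.log_pow]
    have h1 := Real.log_le_sub_one_of_pos (by linarith : 0 < Real.logb 2 (2 * m))
    have h2 : Real.logb 2 (2 * m) = 1 + Real.log m / Real.log 2 := by
      rw [Real.logb_mul (by norm_num) (by linarith), Real.logb_self_eq_one (by norm_num)]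
      rfl
    rw [h2] at h1 ⊢
    push_cast
    linarith
  have hlogm2 : Real.log m / Real.log 2 ≤ 1.5 * (18 + 3 * L) := by
    rw [div_le_iff₀ (by linarith)]
    nlinarith
  have h2l : (d : ℝ) * (2 * ℓ) ≤ 2 * L := by simp only [L]; linarith
  have h25 : (d : ℝ) * (25 * Real.log 2) ≤ 26 * L := by nlinarith
  have hδL : Real.log (1 / δ) ≤ L := by
    have : 0 ≤ (d : ℝ) * ℓ := mul_nonneg (by linarith) (by linarith)
    simp only [L]; linarith
  linarith

end Arithmetic

/-! ### The recursion for excess errors and the covering sets for the queries -/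

section Cover

variable {X : Type*} [MeasurableSpace X] {P : Measure (X × Bool)} [IsProbabilityMeasure P]

theorem exists_pos_forall_le {f : ℕ → ℝ} (hf : ∀ i, 0 < f i) (I : ℕ) :
    ∃ τ, 0 < τ ∧ ∀ i ≤ I, τ ≤ f i := by
  obtain ⟨i, -, hi⟩ := Finset.exists_min_image (Finset.range (I + 1)) f ⟨0, by simp⟩
  exact ⟨f i, hf i, fun j hj => hi j (Finset.mem_range.2 (by omega))⟩

theorem errorRate_sub_le_one (f g : X → Bool) : errorRate P f - errorRate P g ≤ 1 := by
  have h1 : errorRate P f ≤ 1 := measureReal_le_one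
  have h2 : 0 ≤ errorRate P g := measureReal_nonneg
  linarith

/-- The recursion for the excess error rates of the candidates of RobustCAL. -/
theorem excess_le_of_concentrated {F : Set (X → Bool)} {d : ℕ} {δ : ℝ} {S : ℕ → X × Bool}
    (hF : ∀ f ∈ F, Measurable f) (hδ : 0 < δ) (hδ2 : δ < 1 / 2) {I : ℕ}
    (hS : ∀ i ≤ I, Concentrated P F (deviationScale d δ (2 ^ i)) fun t : Fin (2 ^ i) => S t)
    {fstar g : X → Bool} (hstar : ∀ h ∈ F, errorRate P fstar ≤ errorRate P h) (hg : g ∈ F)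
    {a α : ℝ} (ha : 1 ≤ a) (hα : 0 ≤ α) (hα1 : α ≤ 1) (hMT : MammenTsybakov P F fstar a α)
    {ρ : ℕ → ℝ} (hρ : ∀ i, 0 < ρ i) (hρ0 : 1 ≤ ρ 0) (hρ2 : ∀ i, ρ i ≤ 2 * ρ (i + 1))
    (hρe : ∀ i ≤ I, 100 * a * deviationScale d δ (2 ^ i) ≤ ρ i ^ (2 - α))
    {τ : ℝ} (hτ : errorRate P g ≤ errorRate P fstar + τ)
    (hτe : ∀ i ≤ I, τ ≤ 12 / 100 * deviationScale d δ (2 ^ i))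
    (hτρ : ∀ i ≤ I, τ ≤ ρ i / 16) (i : ℕ) (hi : i ≤ I) :
    ∀ h ∈ (run F d δ S (2 ^ i)).candidates, errorRate P h - errorRate P fstar ≤ ρ i := by
  have hgmem := mem_run_candidates_of_concentrated hF hδ hδ2 hS hg (τ := τ)
    (fun h hh => by linarith [hstar h hh]) hτe
  induction i with
  | zero => exact fun h _ => (errorRate_sub_le_one h fstar).trans hρ0
  | succ i ih =>
    intro h hh
    -- Targets above `1` hold trivially; below `1` one has `v ^ (2 - α) ≤ v`, so `100 * a * e ≤ v ^
    -- (2 - α)` also controls `e` itself.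
    rcases le_or_gt 1 (ρ (i + 1)) with h1 | h1
    · exact (errorRate_sub_le_one h fstar).trans h1
    have ih := ih (by omega)
    obtain ⟨j, hj⟩ : ∃ j, j + 1 = 2 ^ (i + 1) :=
      ⟨2 ^ (i + 1) - 1, Nat.sub_add_cancel (Nat.one_le_two_pow)⟩
    have hij : 2 ^ i ≤ j := by
      have : 0 < 2 ^ i := by positivity
      rw [pow_succ] at hj; omega
    set e := deviationScale d δ (2 ^ (i + 1))
    have he : 0 ≤ e := deviationScale_nonneg d hδ hδ2 _
    set v := ρ (i + 1)
    have hv : 0 < v := hρ _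
    have hD : ∀ h' ∈ (run F d δ S j).candidates, disagreeProb P h' fstar ≤ 2 * a * v ^ α := by
      intro h' hh'
      have hF' := run_candidates_subset F d δ S j hh'
      have hex := ih h' (run_candidates_antitone F d δ S hij hh')
      have h0 : 0 ≤ errorRate P h' - errorRate P fstar := by linarith [hstar h' hF']
      calc disagreeProb P h' fstar ≤ a * (errorRate P h' - errorRate P fstar) ^ α := hMT h' hF'
        _ ≤ a * (2 * v) ^ α := by
            refine mul_le_mul_of_nonneg_left ?_ (by linarith)
            exact Real.rpow_le_rpow h0 (hex.trans (hρ2 i)) hα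
        _ ≤ a * (2 * v ^ α) := by
            refine mul_le_mul_of_nonneg_left ?_ (by linarith)
            rw [Real.mul_rpow (by norm_num) hv.le]
            refine mul_le_mul_of_nonneg_right ?_ (Real.rpow_nonneg hv.le _)
            simpa using Real.rpow_le_rpow_of_exponent_le (by norm_num : (1 : ℝ) ≤ 2) hα1
        _ = 2 * a * v ^ α := by ring
    have hmain := excess_le_of_mem_run_candidates hF hδ hδ2 hj (hS (i + 1) hi)
      (hgmem j (by have := Nat.pow_le_pow_right (n := 2) (by norm_num) hi; omega)) hD hh
    have hve : 100 * a * e ≤ v ^ (2 - α) := hρe (i + 1) hi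
    have hvα : v ^ α * v ^ (2 - α) = v ^ 2 := by
      rw [← Real.rpow_add hv, ← Real.rpow_natCast]
      congr 1
      push_cast; ring
    have hv1 : v ^ (2 - α) ≤ v := by
      simpa using Real.rpow_le_rpow_of_exponent_ge hv h1.le (by linarith : (1 : ℝ) ≤ 2 - α)
    have he1 : 100 * e ≤ v := by
      have : 100 * e ≤ 100 * a * e := by nlinarith
      linarith
    have hae : 100 * (a * v ^ α * e) ≤ v ^ 2 := by
      have := mul_le_mul_of_nonneg_left hve (Real.rpow_nonneg hv.le α)
      rw [hvα] at this
      linarith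
    -- The recursion closes since `2 * (3/10 + 1/100) + 1/16 < 1`, the last term being the share of
    -- `τ`.
    have hsq : √((4 * (2 * a * v ^ α) + 4 / 10 * e) * e) ≤ 3 / 10 * v := by
      refine Real.sqrt_le_iff.2 ⟨by positivity, ?_⟩
      have : e * e ≤ (v / 100) ^ 2 := by nlinarith
      nlinarith
    have := hτρ (i + 1) hi
    change τ ≤ v / 16 at this
    linarith

/-- The sets in which RobustCAL requests labels while the excess error rates are at most `v`. -/
theorem exists_request_cover {F : Set (X → Bool)} (hF : MeasurableClass P F)
    {fstar : X → Bool} (hfs : Measurable fstar) {a α ε : ℝ} (ha : 1 ≤ a) (hα : 0 ≤ α)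
    (hε : 0 < ε) {B : ℕ}
    (hB : ∀ r, a * ε ^ α < r → r ≤ 1 → compressionBound P F fstar ⌈1 / r⌉₊ (1 / 20) ≤ B)
    {v : ℝ} (hv : ε ≤ v) :
    ∃ W : Set (X × Bool), MeasurableSet W ∧ P.real W ≤ 12 * (B + 1) * (a * v ^ α) ∧
      ∀ f ∈ F, disagreeProb P f fstar ≤ a * v ^ α → ∀ z : X × Bool, f z.1 ≠ fstar z.1 → z ∈ W := by
  have hεα : 0 < ε ^ α := Real.rpow_pos_of_pos hε α
  have hle : ε ^ α ≤ v ^ α := Real.rpow_le_rpow hε.le hv hα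
  have hB0 : (0 : ℝ) ≤ B := Nat.cast_nonneg B
  have hpos : 0 < a * v ^ α := mul_pos (by linarith) (by linarith)
  -- The cover is taken at radius `r = 4 a v^α`, so that `r / 4` is the distance in question. If `r
  -- > 1`, the whole space will do because the claimed bound exceeds `1`.
  rcases le_or_gt (4 * (a * v ^ α)) 1 with h1 | h1
  · have hlt : a * ε ^ α < 4 * (a * v ^ α) := by
      have := mul_le_mul_of_nonneg_left hle (by linarith : 0 ≤ a)
      linarith
    obtain ⟨W, hW, hWP, hWf⟩ := exists_disagreement_cover (P := P) hF hfs
      (r := 4 * (a * v ^ α)) (by positivity)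
    refine ⟨W, hW, hWP.trans ?_, fun f hf hfd => hWf f hf (by linarith)⟩
    have hb : ((compressionBound P F fstar ⌈1 / (4 * (a * v ^ α))⌉₊ (1 / 20) : ℕ) : ℝ) ≤ B :=
      Nat.cast_le.2 (hB _ hlt h1)
    nlinarith
  · refine ⟨Set.univ, MeasurableSet.univ, ?_, fun _ _ _ _ _ => Set.mem_univ _⟩
    rw [probReal_univ]
    nlinarith

end Cover

/-! ### From stagewise bounds to the guarantee -/

section Main

variable {X : Type*}

theorem forall_eq_of_hasVCDim_zero {F : Set (X → Bool)} (hF : HasVCDim F 0) {f g : X → Bool}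
    (hf : f ∈ F) (hg : g ∈ F) : f = g := by
  funext x
  by_contra hne
  have h1 : 1 ≤ 0 := by
    refine hF.2 ⟨{x}, by simp, fun p => ?_⟩
    rcases Bool.eq_or_eq_not (p x) (f x) with h | h
    · exact ⟨f, hf, fun y hy => by rw [Finset.mem_singleton.1 hy, h]⟩
    · refine ⟨g, hg, fun y hy => ?_⟩
      rw [Finset.mem_singleton.1 hy, h]
      cases h1 : f x <;> cases h2 : g x <;> simp_all
  omega

theorem HasVCDim.nonempty {F : Set (X → Bool)} {d : ℕ} (hF : HasVCDim F d) : F.Nonempty := by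
  obtain ⟨s, -, hs⟩ := hF.1
  obtain ⟨f, hf, -⟩ := hs fun _ => true
  exact ⟨f, hf⟩

variable [MeasurableSpace X] {P : Measure (X × Bool)} [IsProbabilityMeasure P]

theorem measure_exists_not_concentrated_le {F : Set (X → Bool)} {d : ℕ} (hF : MeasurableClass P F)
    (hd : HasVCDim F d) (hd1 : 1 ≤ d) {δ : ℝ} (hδ : 0 < δ) (hδ2 : δ < 1 / 2) (I : ℕ) :
    Measure.infinitePi (fun _ : ℕ => P) {S | ¬ ∀ i ≤ I,
      Concentrated P F (deviationScale d δ (2 ^ i)) fun t : Fin (2 ^ i) => S t} ≤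
      ENNReal.ofReal (δ / 4) := by
  have hsub : {S : ℕ → X × Bool | ¬ ∀ i ≤ I,
      Concentrated P F (deviationScale d δ (2 ^ i)) fun t : Fin (2 ^ i) => S t} ⊆
      ⋃ i ∈ Finset.range (I + 1), (fun (S : ℕ → X × Bool) (t : Fin (2 ^ i)) => S t) ⁻¹'
        {S | ¬ Concentrated P F (deviationScale d δ (2 ^ i)) S} := by
    intro S hS
    simp only [Set.mem_ofPred_eq, not_forall] at hS
    obtain ⟨i, hi, h⟩ := hS
    exact Set.mem_biUnion (Finset.mem_coe.2 (Finset.mem_range.2 (by omega))) h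
  refine (measure_mono hsub).trans ((measure_biUnion_finset_le _ _).trans ?_)
  calc ∑ i ∈ Finset.range (I + 1), Measure.infinitePi (fun _ : ℕ => P)
        ((fun (S : ℕ → X × Bool) (t : Fin (2 ^ i)) => S t) ⁻¹'
          {S | ¬ Concentrated P F (deviationScale d δ (2 ^ i)) S})
      ≤ ∑ i ∈ Finset.range (I + 1), ENNReal.ofReal (confidence δ (2 ^ i) / 8) := by
        refine Finset.sum_le_sum fun i _ => ?_
        have hmp := measurePreserving_restrict_fin (μ := P) (2 ^ i)
        -- This inequality holds for arbitrary sets, so measurability of the event is not needed.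
        refine (Measure.le_map_apply hmp.measurable.aemeasurable _).trans ?_
        rw [hmp.map_eq]
        exact measure_not_concentrated_le hF hd hd1 hδ hδ2 Nat.one_le_two_pow
    _ = ENNReal.ofReal (∑ i ∈ Finset.range (I + 1), confidence δ (2 ^ i) / 8) := by
        rw [ENNReal.ofReal_sum_of_nonneg fun i _ =>
          div_nonneg (confidence_pos hδ Nat.one_le_two_pow).le (by norm_num)]
    _ ≤ ENNReal.ofReal (δ / 4) := by
        refine ENNReal.ofReal_le_ofReal ?_
        rw [← Finset.sum_div]
        have := sum_confidence_le hδ I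
        linarith

/-- The guarantee for RobustCAL in terms of a sequence of target excess error rates. -/
theorem robustCAL_guarantee_of_stages {F : Set (X → Bool)} {d : ℕ} (hF : MeasurableClass P F)
    (hd : HasVCDim F d) (hd1 : 1 ≤ d) {fstar : X → Bool} (hfs : IsInfimal P F fstar)
    {a α ε δ : ℝ} (ha : 1 ≤ a) (hα : 0 ≤ α) (hα1 : α ≤ 1)
    (hMT : MammenTsybakov P F fstar a α) (hε : 0 < ε) (hδ : 0 < δ) (hδ2 : δ < 1 / 2) {B : ℕ}
    (hB : ∀ r, a * ε ^ α < r → r ≤ 1 → compressionBound P F fstar ⌈1 / r⌉₊ (1 / 20) ≤ B)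
    {ρ : ℕ → ℝ} (hρ : ∀ i, 0 < ρ i) (hρ0 : 1 ≤ ρ 0) (hρ2 : ∀ i, ρ i ≤ 2 * ρ (i + 1)) {I : ℕ}
    (hρe : ∀ i ≤ I, 100 * a * deviationScale d δ (2 ^ i) ≤ ρ i ^ (2 - α))
    (hρε : ρ I ≤ ε) (hερ : ∀ i < I, ε ≤ ρ i) {Y : ℝ}
    (hY : ∀ i < I, 2 ^ i * (12 * (B + 1) * (a * ρ i ^ α)) ≤ Y) (hY0 : 0 ≤ Y) {k n u : ℕ}
    (hn : 2 * (1 + (2 ^ (I - k) + k * Y)) + Real.log (4 / δ) ≤ n) (hu : 2 ^ I ≤ u)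
    (fhat : (ℕ → X × Bool) → X → Bool)
    (hfhat : ∀ S : ℕ → X × Bool, fhat S ∈ (robustCAL F d δ n u
      (fun i => (S i).1) (fun i => (S i).2)).candidates) :
    Measure.infinitePi (fun _ : ℕ => P)
      {S | ¬ errorRate P (fhat S) ≤ errorRate P fstar + ε} ≤ ENNReal.ofReal δ := by
  classical
  have hstar : ∀ h ∈ F, errorRate P fstar ≤ errorRate P h := fun h hh =>
    hfs.isGLB_errorRate.1 ⟨h, hh, rfl⟩
  obtain ⟨τ, hτ, hτle⟩ := exists_pos_forall_le (f := fun i =>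
    min (12 / 100 * deviationScale d δ (2 ^ i)) (ρ i / 16)) (fun i => lt_min
      (mul_pos (by norm_num) (deviationScale_pos d hδ hδ2 Nat.one_le_two_pow))
      (div_pos (hρ i) (by norm_num))) I
  obtain ⟨g, hg, hgτ⟩ : ∃ g ∈ F, errorRate P g < errorRate P fstar + τ := by
    obtain ⟨_, ⟨g, hg, rfl⟩, -, h⟩ := hfs.isGLB_errorRate.exists_between
      (show errorRate P fstar < errorRate P fstar + τ by linarith)
    exact ⟨g, hg, h⟩
  have hcover : ∀ i, ∃ W : Set (X × Bool), MeasurableSet W ∧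
      (i < I → P.real W ≤ 12 * (B + 1) * (a * ρ i ^ α) ∧ ∀ f ∈ F,
        disagreeProb P f fstar ≤ a * ρ i ^ α → ∀ z : X × Bool, f z.1 ≠ fstar z.1 → z ∈ W) := by
    intro i
    by_cases hi : i < I
    · obtain ⟨W, hW, h1, h2⟩ := exists_request_cover hF hfs.measurable ha hα hε hB (hερ i hi)
      exact ⟨W, hW, fun _ => ⟨h1, h2⟩⟩
    · exact ⟨∅, MeasurableSet.empty, fun h => absurd h hi⟩
  choose W hW hWI using hcover
  -- These sets do not depend on the sample, so the events `S j ∈ W' j` are independent, as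
  -- Chernoff's bound requires; the request events themselves need not be.
  let W' : ℕ → Set (X × Bool) := fun j => if j = 0 then Set.univ else W (Nat.log 2 j)
  have hW' : ∀ j, MeasurableSet (W' j) := fun j => by
    by_cases hj : j = 0
    · simp [W', hj]
    · simpa [W', hj] using hW _
  have hsum : ∑ j ∈ Finset.range (2 ^ I), P.real (W' j) ≤ 1 + (2 ^ (I - k) + k * Y) := by
    have e : ∀ j, P.real (W' j) = if j = 0 then 1 else P.real (W (Nat.log 2 j)) := fun j => by
      by_cases hj : j = 0 <;> simp [W', hj]
    simp_rw [e]
    rw [sum_range_two_pow_log (fun i => P.real (W i)) 1 I]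
    refine add_le_add le_rfl (sum_two_pow_mul_le (fun i => measureReal_le_one)
      (fun i hi => ?_) hY0)
    exact (mul_le_mul_of_nonneg_left (hWI i hi).1 (by positivity)).trans (hY i hi)
  have hch := measure_sum_indicator_ge_le (μ := P) hW' (2 ^ I) (Real.log (4 / δ))
  have hexp : Real.exp (-Real.log (4 / δ)) = δ / 4 := by
    rw [← Real.log_inv, Real.exp_log (by positivity), inv_div]
  rw [hexp] at hch
  have hco := measure_exists_not_concentrated_le hF hd hd1 hδ hδ2 I
  -- The argument is pathwise: on a sample outside both bad events all requests fall into the sets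
  -- `W'`, the budget lasts for `2 ^ I` rounds, and every candidate then has excess error at most `ρ
  -- I ≤ ε`. In particular `fhat` may depend on `S` arbitrarily.
  have hsub : {S : ℕ → X × Bool | ¬ errorRate P (fhat S) ≤ errorRate P fstar + ε} ⊆
      {S | ¬ ∀ i ≤ I,
        Concentrated P F (deviationScale d δ (2 ^ i)) fun t : Fin (2 ^ i) => S t} ∪
      {S | 2 * ∑ i ∈ Finset.range (2 ^ I), P.real (W' i) + Real.log (4 / δ) ≤
        ∑ i ∈ Finset.range (2 ^ I), (W' i).indicator (fun _ => (1 : ℝ)) (S i)} := by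
    intro S hS
    by_contra hgood
    simp only [Set.mem_union, Set.mem_ofPred_eq, not_or, not_not, not_le] at hgood hS
    obtain ⟨hconc, hcount⟩ := hgood
    have hex := excess_le_of_concentrated hF.measurable hδ hδ2 hconc hstar hg ha hα hα1 hMT hρ hρ0
      hρ2 hρe hgτ.le (fun i hi => (hτle i hi).trans (min_le_left _ _))
      (fun i hi => (hτle i hi).trans (min_le_right _ _))
    have hreq : ∀ j < 2 ^ I, (S j).1 ∈ disagreementRegion (run F d δ S j).candidates →
        S j ∈ W' j := by
      intro j hj hdis
      by_cases hj0 : j = 0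
      · simp [W', hj0]
      have hlog : Nat.log 2 j < I := Nat.log_lt_of_lt_pow hj0 hj
      have hanti := run_candidates_antitone F d δ S (Nat.pow_log_le_self 2 hj0)
      have key : ∀ h ∈ (run F d δ S j).candidates, h (S j).1 ≠ fstar (S j).1 → S j ∈ W' j := by
        intro h hh hne
        have hhF := run_candidates_subset F d δ S j hh
        have h1 := hex (Nat.log 2 j) hlog.le h (hanti hh)
        have h2 : disagreeProb P h fstar ≤ a * ρ (Nat.log 2 j) ^ α :=
          (hMT h hhF).trans (mul_le_mul_of_nonneg_left
            (Real.rpow_le_rpow (by linarith [hstar h hhF]) h1 hα) (by linarith))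
        simp only [W', hj0, if_false]
        exact (hWI _ hlog).2 h hhF h2 (S j) hne
      obtain ⟨h, hh, h', hh', hne⟩ := hdis
      by_cases h1 : h (S j).1 = fstar (S j).1
      · exact key h' hh' fun h2 => hne (h1.trans h2.symm)
      · exact key h hh h1
    have hlen : ∀ j < 2 ^ I, (run F d δ S j).requested.length < n := by
      intro j hj
      have h1 := run_requested_length_le F d δ S W' (2 ^ I) hreq j hj.le
      have h2 : ∑ i ∈ Finset.range j, (W' i).indicator (fun _ => (1 : ℝ)) (S i) ≤
          ∑ i ∈ Finset.range (2 ^ I), (W' i).indicator (fun _ => (1 : ℝ)) (S i) :=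
        Finset.sum_le_sum_of_subset_of_nonneg (Finset.range_mono hj.le)
          fun _ _ _ => Set.indicator_nonneg (fun _ _ => zero_le_one) _
      have h3 : ((run F d δ S j).requested.length : ℝ) < n := by linarith
      exact_mod_cast h3
    have hmem := robustCAL_candidates_subset_run F d δ S hu hlen (hfhat S)
    have := hex I le_rfl _ hmem
    linarith
  calc _ ≤ _ := measure_mono hsub
    _ ≤ _ := measure_union_le _ _
    _ ≤ ENNReal.ofReal (δ / 4) + ENNReal.ofReal (δ / 4) := add_le_add hco hch
    _ = ENNReal.ofReal (δ / 4 + δ / 4) := (ENNReal.ofReal_add (by positivity) (by positivity)).symm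
    _ ≤ ENNReal.ofReal δ := ENNReal.ofReal_le_ofReal (by linarith)

end Main

/-! ### Choice of the stage lengths and the resulting label budget -/

section Rate

/-- Numbers of unlabeled points and target excess error rates for which the recursion closes. -/
theorem exists_stage_count {a α ε Λ : ℝ} (hε : 0 < ε)
    (haε : a * ε ^ α ≤ 1) (hε1 : ε ≤ 1) (hΛ : 1 ≤ Λ) :
    ∃ (I : ℕ), 100 * a * Λ / 2 ^ I ≤ ε ^ (2 - α) ∧
      (∀ i < I, ε ^ (2 - α) < 100 * a * Λ / 2 ^ i) ∧ (2 : ℝ) ^ I ≤ 200 * Λ * (1 / ε) ^ 2 := by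
  classical
  have hεα : 0 < ε ^ (2 - α) := Real.rpow_pos_of_pos hε _
  have hex : ∃ I : ℕ, 100 * a * Λ / 2 ^ I ≤ ε ^ (2 - α) := by
    obtain ⟨I, hI⟩ := pow_unbounded_of_one_lt (100 * a * Λ / ε ^ (2 - α)) (by norm_num : (1 : ℝ) < 2)
    refine ⟨I, ?_⟩
    rw [div_lt_iff₀ hεα] at hI
    rw [div_le_iff₀ (by positivity)]
    linarith
  refine ⟨Nat.find hex, Nat.find_spec hex, fun i hi => not_le.1 (Nat.find_min hex hi), ?_⟩
  have hmin : ∀ i < Nat.find hex, ε ^ (2 - α) < 100 * a * Λ / 2 ^ i :=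
    fun i hi => not_le.1 (Nat.find_min hex hi)
  generalize Nat.find hex = I at hmin ⊢
  have h1 : 1 ≤ (1 / ε) ^ 2 := one_le_pow₀ (by rw [le_div_iff₀ hε]; linarith)
  rcases I with _ | I
  · rw [pow_zero]; nlinarith
  -- Minimality at the preceding stage bounds `2 ^ I`; the factor `a` disappears through `a * ε ^ α
  -- ≤ 1`, leaving a bound in terms of `Λ / ε ^ 2` only.
  · have h := hmin I (Nat.lt_succ_self I)
    rw [lt_div_iff₀ (by positivity)] at h
    have hmul : ε ^ α * ε ^ (2 - α) = ε ^ 2 := by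
      rw [← Real.rpow_add hε, ← Real.rpow_natCast]
      congr 1
      push_cast; ring
    have h2 : ε ^ 2 * 2 ^ I ≤ 100 * Λ := by
      calc ε ^ 2 * 2 ^ I = ε ^ α * (ε ^ (2 - α) * 2 ^ I) := by rw [← hmul]; ring
        _ ≤ ε ^ α * (100 * a * Λ) :=
          mul_le_mul_of_nonneg_left h.le (Real.rpow_nonneg hε.le _)
        _ = 100 * Λ * (a * ε ^ α) := by ring
        _ ≤ 100 * Λ := mul_le_of_le_one_right (by linarith) haε
    rw [pow_succ, one_div, inv_pow, ← div_eq_mul_inv, le_div_iff₀ (by positivity)]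
    linarith

theorem stage_rate_rpow {a α Λ : ℝ} (ha : 1 ≤ a) (hα1 : α ≤ 1) (hΛ : 1 ≤ Λ) (i : ℕ) :
    ((100 * a * Λ / 2 ^ i) ^ (1 / (2 - α))) ^ (2 - α) = 100 * a * Λ / 2 ^ i := by
  rw [← Real.rpow_mul (by positivity), one_div_mul_cancel (by linarith), Real.rpow_one]

theorem stage_rate_le {a α Λ : ℝ} (ha : 1 ≤ a) (hα1 : α ≤ 1) (hΛ : 1 ≤ Λ) (i : ℕ) :
    (100 * a * Λ / 2 ^ i) ^ (1 / (2 - α)) ≤ 2 * (100 * a * Λ / 2 ^ (i + 1)) ^ (1 / (2 - α)) := by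
  have e : 100 * a * Λ / 2 ^ i = 2 * (100 * a * Λ / 2 ^ (i + 1)) := by
    rw [pow_succ]; field_simp
  rw [e, Real.mul_rpow (by norm_num) (by positivity)]
  refine mul_le_mul_of_nonneg_right ?_ (by positivity)
  have : 1 / (2 - α) ≤ 1 := by
    rw [div_le_one (by linarith)]; linarith
  simpa using Real.rpow_le_rpow_of_exponent_le (by norm_num : (1 : ℝ) ≤ 2) this

/-- Substituting `2 ^ i = 100 a Λ / v ^ (2 - α)` leaves the power `v ^ (2 α - 2)`, which is largest
at `v = ε` because `α ≤ 1`. The second factor `a` comes from this substitution. -/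
theorem request_rate_le {a α ε Λ v : ℝ} {B i : ℕ} (ha : 1 ≤ a) (hα1 : α ≤ 1) (hε : 0 < ε)
    (hΛ : 1 ≤ Λ) (hv : ε ≤ v) (hvr : v ^ (2 - α) = 100 * a * Λ / 2 ^ i) :
    2 ^ i * (12 * (B + 1) * (a * v ^ α)) ≤
      1200 * (a ^ 2 * (B + 1) * (1 / ε) ^ (2 - 2 * α)) * Λ := by
  have hv0 : 0 < v := hε.trans_le hv
  have h1 : v ^ α = v ^ (2 - α) * (1 / v) ^ (2 - 2 * α) := by
    rw [one_div, Real.inv_rpow hv0.le, ← Real.rpow_neg hv0.le, ← Real.rpow_add hv0]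
    congr 1
    ring
  have h2 : (1 / v) ^ (2 - 2 * α) ≤ (1 / ε) ^ (2 - 2 * α) :=
    Real.rpow_le_rpow (by positivity) (one_div_le_one_div_of_le hε hv) (by linarith)
  have h3 : (2 : ℝ) ^ i * (12 * (B + 1) * (a * v ^ α)) =
      1200 * (a ^ 2 * (B + 1) * (1 / v) ^ (2 - 2 * α)) * Λ := by
    rw [h1, hvr]
    field_simp
    ring
  rw [h3]
  gcongr

/-- With `2 ^ I ≤ 200 Λ / ε ^ 2`, the stages before the last `k` have at most about `2 Λ` points in
total, while `k` is only logarithmic in `1 / ε`. -/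
theorem exists_stage_window {ε : ℝ} (hε : 0 < ε) (hε2 : ε < 1 / 2) :
    ∃ k : ℕ, 100 * (1 / ε) ^ 2 ≤ (2 : ℝ) ^ k ∧ (k : ℝ) ≤ 15 * Real.log (1 / ε) := by
  have hlog1 := Real.log_two_gt_d9
  have hE : 2 ≤ 1 / ε := by rw [le_div_iff₀ hε]; linarith
  have hℓ : Real.log 2 ≤ Real.log (1 / ε) := Real.log_le_log (by norm_num) hE
  have hpos : (1 : ℝ) ≤ 100 * (1 / ε) ^ 2 := by nlinarith
  refine ⟨⌈Real.logb 2 (100 * (1 / ε) ^ 2)⌉₊, ?_, ?_⟩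
  · have h := Nat.le_ceil (Real.logb 2 (100 * (1 / ε) ^ 2))
    rw [Real.logb_le_iff_le_rpow (by norm_num) (by linarith), Real.rpow_natCast] at h
    exact h
  · have h := Nat.ceil_lt_add_one (Real.logb_nonneg (by norm_num : (1 : ℝ) < 2) hpos)
    refine h.le.trans ?_
    have h128 : Real.log 100 ≤ 7 * Real.log 2 := by
      have : Real.log 100 ≤ Real.log (2 ^ 7) := Real.log_le_log (by norm_num) (by norm_num)
      rwa [Real.log_pow] at this
    have h2 : Real.logb 2 (100 * (1 / ε) ^ 2) ≤ 7 + 2 * (Real.log (1 / ε) * 1.45) := by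
      unfold Real.logb
      rw [div_le_iff₀ (by linarith), Real.log_mul (by norm_num) (by positivity), Real.log_pow]
      push_cast
      nlinarith
    linarith

theorem budget_le {d : ℕ} (hd : 1 ≤ d) {ε δ G Λ : ℝ} (hε : 0 < ε) (hε2 : ε < 1 / 2) (hδ : 0 < δ)
    (hδ2 : δ < 1 / 2) (hG : 1 ≤ G)
    (hΛ : Λ = 2 ^ 17 * (d * Real.log (1 / ε) + Real.log (1 / δ))) {I k : ℕ}
    (hI : (2 : ℝ) ^ I ≤ 200 * Λ * (1 / ε) ^ 2) (hk : 100 * (1 / ε) ^ 2 ≤ (2 : ℝ) ^ k)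
    (hk2 : (k : ℝ) ≤ 15 * Real.log (1 / ε)) :
    2 * (1 + (2 ^ (I - k) + k * (1200 * G * Λ))) + Real.log (4 / δ) ≤
      2 ^ 33 * G * (d * Real.log (1 / ε) + Real.log (1 / δ)) * Real.log (1 / ε) := by
  have hlog1 := Real.log_two_gt_d9
  have hlog2 := Real.log_two_lt_d9
  have hd' : (1 : ℝ) ≤ d := by exact_mod_cast hd
  have hE : 2 ≤ 1 / ε := by rw [le_div_iff₀ hε]; linarith
  have hD : 2 ≤ 1 / δ := by rw [le_div_iff₀ hδ]; linarith
  set ℓ := Real.log (1 / ε)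
  have hℓ : Real.log 2 ≤ ℓ := Real.log_le_log (by norm_num) hE
  have hδl : Real.log 2 ≤ Real.log (1 / δ) := Real.log_le_log (by norm_num) hD
  set L := (d : ℝ) * ℓ + Real.log (1 / δ)
  have hdℓ : ℓ ≤ d * ℓ := le_mul_of_one_le_left (by linarith) hd'
  have hL1 : 1 ≤ L := by simp only [L]; linarith
  have hδL : Real.log (1 / δ) ≤ L := by simp only [L]; linarith
  have hpow : (2 : ℝ) ^ (I - k) ≤ 1 + 2 * Λ := by
    rcases le_total I k with h | h
    · rw [Nat.sub_eq_zero_of_le h, pow_zero, hΛ]; linarith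
    · have e : (2 : ℝ) ^ (I - k) * 2 ^ k = 2 ^ I := by rw [← pow_add, Nat.sub_add_cancel h]
      have hx : (0 : ℝ) < 2 ^ k := by positivity
      have hΛ0 : 0 ≤ Λ := by rw [hΛ]; linarith
      have : (2 : ℝ) ^ (I - k) * 2 ^ k ≤ 2 * Λ * 2 ^ k := by
        rw [e]
        nlinarith [mul_le_mul_of_nonneg_left hk hΛ0]
      have := le_of_mul_le_mul_right this hx
      linarith
  have h4 : Real.log (4 / δ) = 2 * Real.log 2 + Real.log (1 / δ) := by
    rw [show (4 : ℝ) / δ = 2 ^ 2 * (1 / δ) by ring, Real.log_mul (by norm_num) (by positivity),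
      Real.log_pow]
    push_cast; ring
  have hGL : L ≤ G * L := le_mul_of_one_le_left (by linarith) hG
  have hGLℓ : G * L ≤ 1.45 * (G * L * ℓ) := by nlinarith
  have hkY : (k : ℝ) * (1200 * G * Λ) ≤ 18000 * 2 ^ 17 * (G * L * ℓ) := by
    rw [hΛ]
    calc (k : ℝ) * (1200 * G * (2 ^ 17 * L)) = 1200 * 2 ^ 17 * (G * L) * k := by ring
      _ ≤ 1200 * 2 ^ 17 * (G * L) * (15 * ℓ) :=
        mul_le_mul_of_nonneg_left hk2 (by linarith)
      _ = _ := by ring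
  rw [h4]
  rw [hΛ] at hpow
  have e : 2 ^ 33 * G * L * ℓ = 2 ^ 33 * (G * L * ℓ) := by ring
  rw [e]
  linarith

end Rate

/-! ### Assembly of the guarantee and the degenerate cases -/

section Main

variable {X : Type*} [MeasurableSpace X] {P : Measure (X × Bool)} [IsProbabilityMeasure P]

theorem robustCAL_guarantee {F : Set (X → Bool)} {d : ℕ} (hF : MeasurableClass P F)
    (hd : HasVCDim F d) (hd1 : 1 ≤ d) {fstar : X → Bool} (hfs : IsInfimal P F fstar)
    {a α ε δ : ℝ} (ha : 1 ≤ a) (hα : 0 ≤ α) (hα1 : α ≤ 1)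
    (hMT : MammenTsybakov P F fstar a α) (hε : 0 < ε) (hε2 : ε < 1 / 2) (hδ : 0 < δ)
    (hδ2 : δ < 1 / 2) (haε : a * ε ^ α ≤ 1) {B : ℕ}
    (hB : ∀ r, a * ε ^ α < r → r ≤ 1 → compressionBound P F fstar ⌈1 / r⌉₊ (1 / 20) ≤ B) :
    ∃ u₀ : ℕ, ∀ n u : ℕ, u₀ ≤ u →
      2 ^ 33 * (a ^ 2 * (B + 1) * (1 / ε) ^ (2 - 2 * α)) *
        (d * Real.log (1 / ε) + Real.log (1 / δ)) * Real.log (1 / ε) ≤ n →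
      ∀ fhat : (ℕ → X × Bool) → X → Bool,
        (∀ S : ℕ → X × Bool, fhat S ∈ (robustCAL F d δ n u
          (fun i => (S i).1) (fun i => (S i).2)).candidates) →
        Measure.infinitePi (fun _ : ℕ => P)
          {S | ¬ errorRate P (fhat S) ≤ errorRate P fstar + ε} ≤ ENNReal.ofReal δ := by
  have hlog1 := Real.log_two_gt_d9
  have hd' : (1 : ℝ) ≤ d := by exact_mod_cast hd1
  have hE : 2 ≤ 1 / ε := by rw [le_div_iff₀ hε]; linarith
  have hD : 2 ≤ 1 / δ := by rw [le_div_iff₀ hδ]; linarith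
  have hℓ : Real.log 2 ≤ Real.log (1 / ε) := Real.log_le_log (by norm_num) hE
  have hδl : Real.log 2 ≤ Real.log (1 / δ) := Real.log_le_log (by norm_num) hD
  have hdℓ : Real.log (1 / ε) ≤ d * Real.log (1 / ε) := le_mul_of_one_le_left (by linarith) hd'
  set Λ := 2 ^ 17 * ((d : ℝ) * Real.log (1 / ε) + Real.log (1 / δ)) with hΛdef
  have hΛ : 1 ≤ Λ := by rw [hΛdef]; linarith
  set G := a ^ 2 * ((B : ℝ) + 1) * (1 / ε) ^ (2 - 2 * α)
  have hG : 1 ≤ G := by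
    have h1 : 1 ≤ a ^ 2 := one_le_pow₀ ha
    have h2 : 1 ≤ (B : ℝ) + 1 := by linarith [(Nat.cast_nonneg B : (0 : ℝ) ≤ B)]
    have h3 : 1 ≤ (1 / ε) ^ (2 - 2 * α) := Real.one_le_rpow (by linarith) (by linarith)
    exact one_le_mul_of_one_le_of_one_le (one_le_mul_of_one_le_of_one_le h1 h2) h3
  obtain ⟨I, hI1, hI2, hI3⟩ := exists_stage_count hε haε (by linarith) hΛ
  obtain ⟨k, hk1, hk2⟩ := exists_stage_window hε hε2
  have hbudget := budget_le hd1 hε hε2 hδ hδ2 hG hΛdef hI3 hk1 hk2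
  -- This choice solves the closing condition of the recursion, with `Λ` bounding `2 ^ i *
  -- deviationScale d δ (2 ^ i)` for all `i ≤ I`. One stage at most halves it, as `1 / (2 - α) ≤ 1`.
  let ρ : ℕ → ℝ := fun i => (100 * a * Λ / 2 ^ i) ^ (1 / (2 - α))
  have hρ : ∀ i, 0 < ρ i := fun i => Real.rpow_pos_of_pos (by positivity) _
  have hρr : ∀ i, ρ i ^ (2 - α) = 100 * a * Λ / 2 ^ i := stage_rate_rpow ha hα1 hΛ
  have hρ0 : 1 ≤ ρ 0 := by
    refine Real.one_le_rpow ?_ (by rw [one_div, inv_nonneg]; linarith)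
    rw [pow_zero, div_one]
    nlinarith
  have hρε : ρ I ≤ ε := by
    refine (Real.rpow_le_rpow_iff (hρ I).le hε.le (by linarith : 0 < 2 - α)).1 ?_
    rw [hρr]
    exact hI1
  have hερ : ∀ i < I, ε ≤ ρ i := fun i hi => by
    refine (Real.rpow_le_rpow_iff hε.le (hρ i).le (by linarith : 0 < 2 - α)).1 ?_
    rw [hρr]
    exact (hI2 i hi).le
  have hρe : ∀ i ≤ I, 100 * a * deviationScale d δ (2 ^ i) ≤ ρ i ^ (2 - α) := by
    intro i hi
    have hpow : (2 : ℝ) ^ i ≤ 2 ^ I := pow_le_pow_right₀ (by norm_num) hi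
    have h := mul_deviationScale_le hd1 hε hε2 hδ hδ2 (m := 2 ^ i) Nat.one_le_two_pow (by
      push_cast
      refine hpow.trans (hI3.trans ?_)
      refine mul_le_mul_of_nonneg_right ?_ (by positivity)
      rw [hΛdef]
      linarith)
    push_cast at h
    rw [hρr, le_div_iff₀ (by positivity)]
    calc 100 * a * deviationScale d δ (2 ^ i) * 2 ^ i
        = 100 * a * (2 ^ i * deviationScale d δ (2 ^ i)) := by ring
      _ ≤ 100 * a * Λ := mul_le_mul_of_nonneg_left h (by positivity)
  refine ⟨2 ^ I, fun n u hu hn fhat hfhat => ?_⟩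
  exact robustCAL_guarantee_of_stages hF hd hd1 hfs ha hα hα1 hMT hε hδ hδ2 hB hρ hρ0
    (stage_rate_le ha hα1 hΛ) hρe hρε hερ
    (fun i hi => request_rate_le ha hα1 hε hΛ (hερ i hi) (hρr i)) (by positivity)
    (hbudget.trans hn) hu fhat hfhat

theorem mammenTsybakov_one_zero (F : Set (X → Bool)) (fstar : X → Bool) :
    MammenTsybakov P F fstar 1 0 := fun f _ => by
  rw [Real.rpow_zero, one_mul]
  exact measureReal_le_one

end Main

end ActiveLearning

theorem mainTheorem11 :
    ∃ c : ℝ, 0 < c ∧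
      ∀ (X : Type*) [MeasurableSpace X] (P : Measure (X × Bool)) [IsProbabilityMeasure P]
        (F : Set (X → Bool)) (d : ℕ) (fstar : X → Bool) (a α ε δ : ℝ),
        ActiveLearning.MeasurableClass P F →
        ActiveLearning.HasVCDim F d →
        ActiveLearning.IsInfimal P F fstar →
        1 ≤ a → 0 ≤ α → α ≤ 1 →
        ActiveLearning.MammenTsybakov P F fstar a α →
        0 < ε → ε < 1 / 2 → 0 < δ → δ < 1 / 2 →
        -- at most `n` labels are requested, and the classifier to be returned exists and is in `F`
        (∀ (n u : ℕ) (point : ℕ → X) (label : ℕ → Bool),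
          (ActiveLearning.robustCAL F d δ n u point label).requested.length ≤ n ∧
          (ActiveLearning.robustCAL F d δ n u point label).candidates.Nonempty ∧
          (ActiveLearning.robustCAL F d δ n u point label).candidates ⊆ F) ∧
        -- guarantee on the error rate, however the returned classifier `fhat` is chosen
        ∃ u₀ : ℕ, ∀ n u : ℕ, u₀ ≤ u →
          c * a ^ 2 * ((ActiveLearning.maxCompressionBound P F fstar (a * ε ^ α) : ℝ) + 1) *
              (1 / ε) ^ (2 - 2 * α) * (d * Real.log (1 / ε) + Real.log (1 / δ)) *
              Real.log (1 / ε) ≤ n →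
          ∀ fhat : (ℕ → X × Bool) → X → Bool,
            (∀ S : ℕ → X × Bool, fhat S ∈ (ActiveLearning.robustCAL F d δ n u
              (fun i => (S i).1) (fun i => (S i).2)).candidates) →
            Measure.infinitePi (fun _ : ℕ => P)
              {S | ¬ ActiveLearning.errorRate P (fhat S) ≤
                ActiveLearning.errorRate P fstar + ε} ≤ ENNReal.ofReal δ := by
  refine ⟨2 ^ 33, by norm_num, ?_⟩
  intro X _ P _ F d fstar a α ε δ hF hd hfs ha hα hα1 hMT hε hε2 hδ hδ2
  have hbasic := ActiveLearning.robustCAL_basic F hd.nonempty d hδ hδ2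
  refine ⟨hbasic, ?_⟩
  have hE : 1 ≤ 1 / ε := by rw [le_div_iff₀ hε]; linarith
  have hD : 1 ≤ 1 / δ := by rw [le_div_iff₀ hδ]; linarith
  set B := ActiveLearning.maxCompressionBound P F fstar (a * ε ^ α)
  have hr₀ : 0 < a * ε ^ α := mul_pos (by linarith) (Real.rpow_pos_of_pos hε _)
  -- For `d = 0` the class is a single classifier, whose error rate is the infimum, so no labels are
  -- needed.
  rcases Nat.eq_zero_or_pos d with rfl | hd1
  · refine ⟨0, fun n u _ _ fhat hfhat => ?_⟩
    have hempty : {S : ℕ → X × Bool | ¬ ActiveLearning.errorRate P (fhat S) ≤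
        ActiveLearning.errorRate P fstar + ε} = ∅ := by
      refine Set.eq_empty_of_forall_notMem fun S hS => hS ?_
      have hmem := (hbasic n u _ _).2.2 (hfhat S)
      obtain ⟨_, ⟨g, hg, rfl⟩, -, h⟩ := hfs.isGLB_errorRate.exists_between
        (show ActiveLearning.errorRate P fstar < ActiveLearning.errorRate P fstar + ε by linarith)
      rw [ActiveLearning.forall_eq_of_hasVCDim_zero hd hmem hg]
      exact h.le
    rw [hempty, measure_empty]
    exact bot_le
  rcases le_or_gt (a * ε ^ α) 1 with haε | haε
  · obtain ⟨u₀, h⟩ := ActiveLearning.robustCAL_guarantee hF hd hd1 hfs ha hα hα1 hMT hε hε2 hδ hδ2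
      haε (B := B) fun r hr _ => ActiveLearning.compressionBound_le_max F fstar hr₀ hr
    refine ⟨u₀, fun n u hu hn => h n u hu (le_trans (le_of_eq ?_) hn)⟩
    ring
  -- If `a * ε ^ α > 1`, the trivial noise condition with parameters `1` and `0` is used instead. No
  -- radius satisfies `1 < r ≤ 1`, so the condition on `B` is vacuous, and the rate `ε⁻²` is at most
  -- `a² ε^(2α - 2)` because `ε^(-α) < a`.
  · obtain ⟨u₀, h⟩ := ActiveLearning.robustCAL_guarantee hF hd hd1 hfs le_rfl le_rfl zero_le_one
      (ActiveLearning.mammenTsybakov_one_zero F fstar) hε hε2 hδ hδ2 (by simp) (B := B)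
      fun r hr hr1 => by
        rw [Real.rpow_zero, one_mul] at hr
        exact absurd hr1 (not_le.2 hr)
    refine ⟨u₀, fun n u hu hn => h n u hu (le_trans ?_ hn)⟩
    have hL : 0 ≤ (d : ℝ) * Real.log (1 / ε) + Real.log (1 / δ) :=
      add_nonneg (mul_nonneg (Nat.cast_nonneg d) (Real.log_nonneg hE)) (Real.log_nonneg hD)
    have hℓ : 0 ≤ Real.log (1 / ε) := Real.log_nonneg hE
    have hkey : (1 / ε) ^ (2 - 2 * (0 : ℝ)) ≤ a ^ 2 * (1 / ε) ^ (2 - 2 * α) := by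
      have h1 : (1 / ε) ^ (2 - 2 * (0 : ℝ)) = ((1 / ε) ^ α) ^ 2 * (1 / ε) ^ (2 - 2 * α) := by
        rw [← Real.rpow_natCast ((1 / ε) ^ α), ← Real.rpow_mul (by positivity),
          ← Real.rpow_add (by positivity)]
        congr 1
        push_cast; ring
      have h2 : (1 / ε) ^ α ≤ a := by
        rw [one_div, Real.inv_rpow hε.le, inv_le_iff_one_le_mul₀ (Real.rpow_pos_of_pos hε α)]
        exact haε.le
      rw [h1]
      gcongr
    calc 2 ^ 33 * (1 ^ 2 * ((B : ℝ) + 1) * (1 / ε) ^ (2 - 2 * (0 : ℝ))) *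
          (d * Real.log (1 / ε) + Real.log (1 / δ)) * Real.log (1 / ε)
        = 2 ^ 33 * ((B : ℝ) + 1) * (1 / ε) ^ (2 - 2 * (0 : ℝ)) *
          (d * Real.log (1 / ε) + Real.log (1 / δ)) * Real.log (1 / ε) := by ring
      _ ≤ 2 ^ 33 * ((B : ℝ) + 1) * (a ^ 2 * (1 / ε) ^ (2 - 2 * α)) *
          (d * Real.log (1 / ε) + Real.log (1 / δ)) * Real.log (1 / ε) := by gcongr
      _ = _ := by ring
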